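/- Let $p>2$. For an integer $H\ge 1$ and $\ell>0$, let $\mathcal{G}=\mathcal{G}_{H,\ell}$ be the broom graph: one compact edge (pendant) $\kappa=[0,\ell]$ and $H$ half-lines $h=[0,\infty)$, all glued at the common vertex $x=0$. Let $H^1(\mathcal{G})$ be the space of continuous functions $u:\mathcal{G}\to\mathbb{R}$ whose restriction $u_e$ to each edge $e$ is in $H^1$. A bound-state is a nontrivial $u\in H^1(\mathcal{G})$ with $\int_{\mathcal{G}} \big(u'\eta'+u\eta-|u|^{p-2}u\eta\big)=0$ for all $\eta\in H^1(\mathcal{G})$. Call $u$ symmetric if $u_{h_1}=u_{h_2}$ for any two half-lines, and increasing if $u$ is (strictly) increasing on $[0,\ell]$ and (strictly) decreasing on each half-line. Let $\varphi(x)=(p/2)^{1/(p-2)}\operatorname{sech}^{2/(p-2)}\big(\tfrac{p-2}{2}x\big)$. For a bound-state $u$ such that, for some $y>0$, $u_h=\varphi(\cdot+y)$ on $H^+$ half-lines and $u_h=\varphi(\cdot-y)$ on the remaining $H^-=H-H^+$ half-lines, the incidence index is $\theta=H^+-H^-$. 1. There exists $H_0=H_0(p)$ such that for every integer $H\ge H_0$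 there are $0<\ell_1<\ell_2$ (depending on $p$ and $H$) with the following property: for every $\ell\in[\ell_1,\ell_2]$ there exist at least two distinct increasing symmetric positive bound-states on $\mathcal{G}_{H,\ell}$, all with incidence index $\theta=H=H^+$. 2. For every $H\ge 3$ there exists $\ell_0=\ell_0(p,H)>0$ such that for every $0<\ell<\ell_0$ and every $\mu>0$ the variational problem $$\mathcal{I}_{\mathcal{G}}(\mu)=\inf_{u\in H^1(\mathcal{G})}\Big\{\tfrac12\|u'\|_{L^2(\mathcal{G})}^2+\tfrac12\|u\|_{L^2(\mathcal{G})}^2:\ \tfrac1p\|u\|_{L^p(\mathcal{G})}^p=\mu\Big\}$$ on $\mathcal{G}=\mathcal{G}_{H,\ell}$ has no minimizer. -/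

import Mathlib

open Set MeasureTheory

noncomputable section

namespace Broom

/-- Edges of the broom graph with `H` half-lines: `none` is the unique compact edge (a pendant),
`some h` is the `h`-th half-line. -/
abbrev Edge (H : ℕ) := Option (Fin H)

/-- The interval with which an edge is identified: `[0, ℓ]` for the pendant and `[0, ∞)` for a
half-line. In both cases the common vertex of all the edges is the point `x = 0`. -/
def dom {H : ℕ} (ℓ : ℝ) : Edge H → Set ℝ
  | none => Icc 0 ℓ
  | some _ => Ici 0

/-- The integral over the broom graph of a function given edge by edge. -/
def graphIntegral {H : ℕ} (ℓ : ℝ) (F : Edge H → ℝ → ℝ) : ℝ :=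
  ∑ e : Edge H, ∫ x in dom ℓ e, F e x

/-- An element of `H¹` of the broom graph, together with (a representative of) its derivative:
on every edge `val e` is in `L²`, is absolutely continuous with derivative `grad e` in `L²`,
and the values of all the edges at the common vertex coincide.
Values outside the interval of the edge are irrelevant. -/
structure H1 (H : ℕ) (ℓ : ℝ) where
  val : Edge H → ℝ → ℝ
  grad : Edge H → ℝ → ℝ
  memLp_val : ∀ e, MemLp (val e) 2 (volume.restrict (dom ℓ e))
  memLp_grad : ∀ e, MemLp (grad e) 2 (volume.restrict (dom ℓ e))
  val_eq : ∀ e, ∀ x ∈ dom ℓ e, val e x = val e 0 + ∫ t in (0 : ℝ)..x, grad e t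
  vertex : ∀ e₁ e₂, val e₁ 0 = val e₂ 0

variable {H : ℕ} {ℓ : ℝ}

/-- `u` and `v` are different functions on the graph. -/
def H1.Distinct (u v : H1 H ℓ) : Prop :=
  ∃ e, ∃ x ∈ dom ℓ e, u.val e x ≠ v.val e x

/-- Bound-states: nontrivial weak solutions of `-u'' + u = |u|^(p-2) u` on the graph. -/
def H1.IsBoundState (p : ℝ) (u : H1 H ℓ) : Prop :=
  (∃ e, ∃ x ∈ dom ℓ e, u.val e x ≠ 0) ∧
  ∀ η : H1 H ℓ,
    graphIntegral ℓ (fun e x =>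
      u.grad e x * η.grad e x + u.val e x * η.val e x
        - |u.val e x| ^ (p - 2) * u.val e x * η.val e x) = 0

def H1.IsPositive (u : H1 H ℓ) : Prop :=
  ∀ e, ∀ x ∈ dom ℓ e, 0 < u.val e x

/-- Symmetric: `u` is the same on any two half-lines. (The requirement that `u` be the same on any
two compact edges is void, as there is only one compact edge.) -/
def H1.IsSymmetric (u : H1 H ℓ) : Prop :=
  ∀ h₁ h₂ : Fin H, ∀ x : ℝ, 0 ≤ x → u.val (some h₁) x = u.val (some h₂) x

/-- Increasing: `u` increases on the compact edge and decreases on each half-line, where each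
edge is oriented away from the common vertex. -/
def H1.IsIncreasing (u : H1 H ℓ) : Prop :=
  StrictMonoOn (u.val none) (Icc 0 ℓ) ∧ ∀ h : Fin H, StrictAntiOn (u.val (some h)) (Ici 0)

/-- The real-line soliton `φ(x) = (p/2)^(1/(p-2)) sech^(2/(p-2)) ((p-2)x/2)`. -/
def soliton (p x : ℝ) : ℝ :=
  (p / 2) ^ (1 / (p - 2)) * (1 / Real.cosh ((p - 2) / 2 * x)) ^ (2 / (p - 2))

/-- The half-lines on which `u = φ(· + y)`. -/
def H1.solitonHalfLines (p y : ℝ) (u : H1 H ℓ) : Set (Fin H) :=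
  {h | ∀ x : ℝ, 0 ≤ x → u.val (some h) x = soliton p (x + y)}

/-- `u` has incidence index `θ`, with `Hplus` half-lines on which `u = φ(· + y)` and `Hminus`
half-lines on which `u = φ(· - y)`, for one common `y > 0`; these are all the half-lines.
In general `θ = (H⁺ - H⁻) / (P + 2L)` for `P` pendants and `L` loops; here `P = 1`, `L = 0`. -/
def H1.HasIncidenceIndex (p : ℝ) (u : H1 H ℓ) (θ : ℝ) (Hplus Hminus : ℕ) : Prop :=
  (∃ y : ℝ, 0 < y ∧
    (∀ h, h ∈ u.solitonHalfLines p y ∨ h ∈ u.solitonHalfLines p (-y)) ∧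
    (u.solitonHalfLines p y).ncard = Hplus ∧
    (u.solitonHalfLines p (-y)).ncard = Hminus) ∧
  θ = ((Hplus : ℝ) - (Hminus : ℝ)) / (1 + 2 * 0)

/-- The functional `I(u) = ½‖u'‖₂² + ½‖u‖₂²`. -/
def H1.energy (u : H1 H ℓ) : ℝ :=
  1 / 2 * graphIntegral ℓ (fun e x => u.grad e x ^ 2)
    + 1 / 2 * graphIntegral ℓ (fun e x => u.val e x ^ 2)

/-- The constraint `(1/p) ‖u‖_p^p = μ`. -/
def H1.MeetsConstraint (p μ : ℝ) (u : H1 H ℓ) : Prop :=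
  1 / p * graphIntegral ℓ (fun e x => |u.val e x| ^ p) = μ

/-- The level `𝓘(μ)`: the infimum of `I` under the constraint. -/
def variationalLevel (p μ : ℝ) (H : ℕ) (ℓ : ℝ) : ℝ :=
  sInf (H1.energy '' {u : H1 H ℓ | u.MeetsConstraint p μ})

/-- `u` solves the variational problem: it meets the constraint and attains the infimum. -/
def H1.IsMinimizer (p μ : ℝ) (u : H1 H ℓ) : Prop :=
  u.MeetsConstraint p μ ∧ u.energy = variationalLevel p μ H ℓ

end Broom

end

namespace Broom

open Filter Topology

/-! Multiplicity. With `φ(· + y)` on every half-line, only the pendant is left to determine. Let `s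
= φ(y)` and `d = quad p s`. Kirchhoff's condition gives the pendant velocity `H √d` at the vertex,
and conservation of `u'^2 - quad p u` gives it energy `(H^2 - 1) d`. The Neumann condition at the
free end then says that `ℓ` equals `L(d) = time p ((H^2 - 1) d) (H √d)`, the time in which the
velocity drops to zero. This time is an integral over the velocity, which has no singularity at the
turning point. Now `L(0) = 0`. At `d = 1 / (H^2 - 1)` the energy is `1` and `L` is at least some `T
> 0` independent of `H`. At `d = quad p (base p)` the energy grows with `H` and, the force being
superlinear, `L` tends to `0`. For `H` large and `T/2 ≤ ℓ ≤ 3T/4`, the intermediate value theorem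
gives a solution of `L(d) = ℓ` on each side of the middle point.

Nonexistence. Write `S = height p`. While `|u| ≤ S`, the Modica–Mortola inequality `u'^2 + quad p u
≥ 2 speed p u |u'|` makes a passage between two values cost at least twice the difference of `cost`.
The soliton on the line attains equality, with total `4 cost S`. The key claim,
`H1.exists_lt_action`, is that every nonzero `u` on a broom with short pendant has a multiple whose
doubled action exceeds `4 cost S`. If the half-lines dominate, normalise their maximum to `S`: one
half-line pays for `v → S → 0`, where `v` is the vertex value, and at least two others pay for `v →
0`, while a short pendant can recover little. If the pendant dominates, its oscillation over a short
length is too expensive.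

On the other hand, a soliton sent to infinity along a half-line shows that the level is at most that
of the line (`variationalLevel_le`). By homogeneity and `sq_sub_rpow_le`, no multiple of a minimizer
can then exceed `4 cost S`, a contradiction. -/

/-! ### Calculus of absolutely continuous functions -/

/-- `f` is a primitive of the integrable function `g` on `[a, b]`. -/
structure IsPrim (f g : ℝ → ℝ) (a b : ℝ) : Prop where
  le : a ≤ b
  int : IntervalIntegrable g volume a b
  eq : ∀ x ∈ Icc a b, f x = f a + ∫ t in a..x, g t

theorem _root_.AbsolutelyContinuousOnInterval.of_dist_le {f h : ℝ → ℝ} {a b K : ℝ}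
    (hf : AbsolutelyContinuousOnInterval f a b) (hK : 0 ≤ K)
    (h_le : ∀ x ∈ uIcc a b, ∀ y ∈ uIcc a b, dist (h x) (h y) ≤ K * dist (f x) (f y)) :
    AbsolutelyContinuousOnInterval h a b := by
  rw [absolutelyContinuousOnInterval_iff] at hf ⊢
  intro ε hε
  -- Dividing by `K + 1` instead of `K` covers `K = 0`.
  obtain ⟨δ, hδ, H⟩ := hf (ε / (K + 1)) (by positivity)
  refine ⟨δ, hδ, fun E hE hEδ => ?_⟩
  have h1 := H E hE hEδ
  calc ∑ i ∈ Finset.range E.1, dist (h (E.2 i).1) (h (E.2 i).2)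
      ≤ ∑ i ∈ Finset.range E.1, K * dist (f (E.2 i).1) (f (E.2 i).2) :=
        Finset.sum_le_sum fun i hi => h_le _ (hE.1 i hi).1 _ (hE.1 i hi).2
    _ = K * ∑ i ∈ Finset.range E.1, dist (f (E.2 i).1) (f (E.2 i).2) := by rw [Finset.mul_sum]
    _ ≤ K * (ε / (K + 1)) := by gcongr
    _ < ε := by
        rw [← mul_div_assoc, div_lt_iff₀ (by positivity)]
        nlinarith

theorem _root_.AbsolutelyContinuousOnInterval.integral_eq_sub_of_ae {F F' : ℝ → ℝ} {a b : ℝ}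
    (hab : a ≤ b) (hF : AbsolutelyContinuousOnInterval F a b)
    (hd : ∀ᵐ x, x ∈ Icc a b → HasDerivAt F (F' x) x) :
    ∫ x in a..b, F' x = F b - F a := by
  rw [← hF.integral_deriv_eq_sub]
  apply intervalIntegral.integral_congr_ae
  filter_upwards [hd] with x hx hxm
  rw [uIoc_of_le hab] at hxm
  exact (hx ⟨hxm.1.le, hxm.2⟩).deriv.symm

namespace IsPrim

variable {f g h k : ℝ → ℝ} {a b c d : ℝ}

theorem mono (hf : IsPrim f g a b) (hac : a ≤ c) (hcd : c ≤ d) (hdb : d ≤ b) :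
    IsPrim f g c d := by
  have hi : ∀ x ∈ Icc a b, IntervalIntegrable g volume a x := fun x hx =>
    hf.int.mono_set (by rw [uIcc_of_le hx.1, uIcc_of_le hf.le]; exact Icc_subset_Icc le_rfl hx.2)
  refine ⟨hcd, hf.int.mono_set ?_, fun x hx => ?_⟩
  · rw [uIcc_of_le hcd, uIcc_of_le hf.le]
    exact Icc_subset_Icc hac hdb
  · have hc : c ∈ Icc a b := ⟨hac, hcd.trans hdb⟩
    have hx' : x ∈ Icc a b := ⟨hac.trans hx.1, hx.2.trans hdb⟩
    rw [hf.eq x hx', hf.eq c hc, ← intervalIntegral.integral_interval_sub_left (hi x hx') (hi c hc)]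
    ring

theorem sub_eq (hf : IsPrim f g a b) (hac : a ≤ c) (hcd : c ≤ d) (hdb : d ≤ b) :
    f d - f c = ∫ t in c..d, g t := by
  rw [(hf.mono hac hcd hdb).eq d ⟨hcd, le_rfl⟩]
  ring

theorem absolutelyContinuous (hf : IsPrim f g a b) : AbsolutelyContinuousOnInterval f a b := by
  refine (hf.int.absolutelyContinuousOnInterval_intervalIntegral left_mem_uIcc).of_dist_le
    zero_le_one fun x hx y hy => ?_
  rw [uIcc_of_le hf.le] at hx hy
  rw [hf.eq x hx, hf.eq y hy]
  simp

theorem continuousOn (hf : IsPrim f g a b) : ContinuousOn f (Icc a b) := by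
  simpa [uIcc_of_le hf.le] using hf.absolutelyContinuous.continuousOn

theorem ae_hasDerivAt (hf : IsPrim f g a b) :
    ∀ᵐ x, x ∈ Icc a b → HasDerivAt f (g x) x := by
  have ha : ∀ᵐ x : ℝ, x ≠ a := by simp [ae_iff, measure_singleton]
  have hb : ∀ᵐ x : ℝ, x ≠ b := by simp [ae_iff, measure_singleton]
  filter_upwards [hf.int.ae_hasDerivAt_integral, ha, hb] with x hx hxa hxb hxm
  have h1 := (hx (by rwa [uIcc_of_le hf.le]) a left_mem_uIcc).const_add (f a)
  refine h1.congr_of_eventuallyEq ?_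
  filter_upwards [Icc_mem_nhds (lt_of_le_of_ne hxm.1 hxa.symm) (lt_of_le_of_ne hxm.2 hxb)]
    with y hy
  exact hf.eq y hy

theorem integral_mul (hf : IsPrim f g a b) (hh : IsPrim h k a b) :
    ∫ x in a..b, (g x * h x + f x * k x) = f b * h b - f a * h a := by
  refine (hf.absolutelyContinuous.fun_mul hh.absolutelyContinuous).integral_eq_sub_of_ae hf.le ?_
  filter_upwards [hf.ae_hasDerivAt, hh.ae_hasDerivAt] with x hx hx' hm
  exact (hx hm).mul (hx' hm)

/-- `Ψ` is C¹, hence Lipschitz on the bounded range of `f`; so `Ψ ∘ f` is absolutely continuous and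
the chain rule holds almost everywhere. -/
theorem integral_comp (hf : IsPrim f g a b) {Ψ ψ : ℝ → ℝ} (hΨ : ∀ x, HasDerivAt Ψ (ψ x) x)
    (hψ : Continuous ψ) : ∫ x in a..b, ψ (f x) * g x = Ψ (f b) - Ψ (f a) := by
  obtain ⟨C, hC⟩ := hf.absolutelyContinuous.exists_bound
  have hc1 : ContDiff ℝ 1 Ψ := by
    rw [contDiff_one_iff_deriv]
    refine ⟨fun x => (hΨ x).differentiableAt, ?_⟩
    rwa [show deriv Ψ = ψ from funext fun x => (hΨ x).deriv]
  obtain ⟨K, hK⟩ := hc1.contDiffOn.exists_lipschitzOnWith (by decide) (convex_Icc (-C) C)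
    isCompact_Icc
  have hmem : ∀ x ∈ uIcc a b, f x ∈ Icc (-C) C := fun x hx => abs_le.1 (hC x hx)
  have hac : AbsolutelyContinuousOnInterval (fun x => Ψ (f x)) a b :=
    hf.absolutelyContinuous.of_dist_le K.2 fun x hx y hy =>
      hK.dist_le_mul _ (hmem x hx) _ (hmem y hy)
  refine hac.integral_eq_sub_of_ae hf.le ?_
  filter_upwards [hf.ae_hasDerivAt] with x hx hm
  exact (hΨ (f x)).comp x (hx hm)

theorem of_hasDerivAt (hab : a ≤ b) (hc : ContinuousOn f (Icc a b))
    (hd : ∀ x ∈ Ioo a b, HasDerivAt f (g x) x) (hg : IntervalIntegrable g volume a b) :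
    IsPrim f g a b := by
  refine ⟨hab, hg, fun x hx => ?_⟩
  rw [intervalIntegral.integral_eq_sub_of_hasDerivAt_of_le hx.1
    (hc.mono (Icc_subset_Icc le_rfl hx.2)) (fun y hy => hd y ⟨hy.1, hy.2.trans_le hx.2⟩)
    (hg.mono_set (by
      rw [uIcc_of_le hx.1, uIcc_of_le hab]; exact Icc_subset_Icc le_rfl hx.2))]
  ring

end IsPrim

/-! ### The space H¹ of the half-line -/

/-- `f`, with derivative `g`, is an element of `H¹` of the half-line. -/
structure IsH1HalfLine (f g : ℝ → ℝ) : Prop where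
  memLp_val : MemLp f 2 (volume.restrict (Ici 0))
  memLp_grad : MemLp g 2 (volume.restrict (Ici 0))
  eq : ∀ x, 0 ≤ x → f x = f 0 + ∫ t in (0 : ℝ)..x, g t

theorem integrable_abs_rpow {f : ℝ → ℝ} {s : Set ℝ} {p B : ℝ} (hp : 2 < p)
    (hs : MeasurableSet s) (hf : MemLp f 2 (volume.restrict s)) (hB : ∀ x ∈ s, |f x| ≤ B) :
    IntegrableOn (fun x => |f x| ^ p) s := by
  refine Integrable.mono' (hf.integrable_sq.const_mul (B ^ (p - 2))) ?_ ?_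
  · exact ((hf.aestronglyMeasurable.aemeasurable.abs).pow_const p).aestronglyMeasurable
  · filter_upwards [ae_restrict_mem hs] with x hx
    rw [Real.norm_of_nonneg (by positivity)]
    have : |f x| ^ p = |f x| ^ (p - 2) * f x ^ 2 := by
      rcases eq_or_ne (f x) 0 with h | h
      · simp [h, Real.zero_rpow (by linarith : p ≠ 0)]
      · rw [← sq_abs (f x), ← Real.rpow_natCast |f x| 2, ← Real.rpow_add (abs_pos.2 h)]
        norm_num
    rw [this]
    have := Real.rpow_le_rpow (abs_nonneg _) (hB x hx) (by linarith : 0 ≤ p - 2)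
    gcongr

namespace IsH1HalfLine

variable {f g h k : ℝ → ℝ}

theorem isPrim (hf : IsH1HalfLine f g) {b : ℝ} (hb : 0 ≤ b) : IsPrim f g 0 b := by
  refine ⟨hb, ?_, fun x hx => hf.eq x hx.1⟩
  rw [intervalIntegrable_iff_integrableOn_Icc_of_le hb]
  have h1 : MemLp g 2 (volume.restrict (Icc 0 b)) :=
    hf.memLp_grad.mono_measure (Measure.restrict_mono Icc_subset_Ici_self le_rfl)
  exact h1.integrable (by norm_num)

theorem isPrim' (hf : IsH1HalfLine f g) {a b : ℝ} (ha : 0 ≤ a) (hab : a ≤ b) : IsPrim f g a b :=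
  (hf.isPrim (ha.trans hab)).mono ha hab le_rfl

theorem continuousOn (hf : IsH1HalfLine f g) : ContinuousOn f (Ici 0) := by
  intro x hx
  have h1 := (hf.isPrim (b := x + 1) (by linarith [mem_Ici.1 hx])).continuousOn x ⟨hx, by linarith⟩
  refine h1.mono_of_mem_nhdsWithin ?_
  rw [← Ici_inter_Iic]
  exact inter_mem self_mem_nhdsWithin (mem_nhdsWithin_of_mem_nhds (Iic_mem_nhds (by linarith)))

theorem integrable_sq_val (hf : IsH1HalfLine f g) : IntegrableOn (fun x => f x ^ 2) (Ici 0) :=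
  hf.memLp_val.integrable_sq

theorem integrable_sq_grad (hf : IsH1HalfLine f g) : IntegrableOn (fun x => g x ^ 2) (Ici 0) :=
  hf.memLp_grad.integrable_sq

/-- The derivative `2 f g` of `f²` is integrable, so `f²` has a limit at infinity; integrability of
`f²` forces that limit to be zero. -/
theorem tendsto_zero (hf : IsH1HalfLine f g) : Tendsto f atTop (𝓝 0) := by
  have hint : IntegrableOn (fun x => g x * f x + f x * g x) (Ioi 0) :=
    (((hf.memLp_grad.integrable_mul hf.memLp_val).add
      (hf.memLp_val.integrable_mul hf.memLp_grad)).mono_measure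
        (Measure.restrict_mono Ioi_subset_Ici_self le_rfl))
  have h1 := intervalIntegral_tendsto_integral_Ioi 0 hint tendsto_id
  have h2 : Tendsto (fun x => f x ^ 2) atTop
      (𝓝 ((∫ x in Ioi 0, (g x * f x + f x * g x)) + f 0 ^ 2)) := by
    refine (h1.add_const (f 0 ^ 2)).congr' ?_
    filter_upwards [eventually_ge_atTop 0] with x hx
    rw [id, (hf.isPrim hx).integral_mul (hf.isPrim hx)]
    ring
  have h3 := IntegrableAtFilter.eq_zero_of_tendsto (μ := volume)
    ⟨Ici 0, Ici_mem_atTop 0, hf.integrable_sq_val⟩ (fun s hs => by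
      obtain ⟨b, hb⟩ := mem_atTop_sets.1 hs
      rw [← top_le_iff, ← Real.volume_Ici (a := b)]
      exact measure_mono hb) h2
  rw [h3] at h2
  have h4 := h2.sqrt
  simp only [Real.sqrt_sq_eq_abs, Real.sqrt_zero] at h4
  exact (tendsto_zero_iff_abs_tendsto_zero f).2 h4

theorem exists_max (hf : IsH1HalfLine f g) : ∃ x₀, 0 ≤ x₀ ∧ ∀ x, 0 ≤ x → |f x| ≤ |f x₀| := by
  by_cases h0 : ∀ x, 0 ≤ x → f x = 0
  · exact ⟨0, le_rfl, fun x hx => by simp [h0 x hx, h0 0 le_rfl]⟩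
  push Not at h0
  obtain ⟨x₁, hx₁, hne⟩ := h0
  have hev : ∀ᶠ x in atTop, |f x| < |f x₁| := by
    have := hf.tendsto_zero.abs
    rw [abs_zero] at this
    exact this.eventually_lt_const (abs_pos.2 hne)
  obtain ⟨R, hR⟩ := eventually_atTop.1 hev
  have hx₁R : x₁ ≤ max R x₁ := le_max_right _ _
  obtain ⟨x₀, hx₀, hmax⟩ := isCompact_Icc.exists_isMaxOn (⟨x₁, hx₁, hx₁R⟩ : (Icc 0 (max R x₁)).Nonempty)
    ((hf.continuousOn.mono Icc_subset_Ici_self).abs)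
  refine ⟨x₀, hx₀.1, fun x hx => ?_⟩
  rcases le_total x (max R x₁) with h | h
  · exact hmax ⟨hx, h⟩
  · exact (hR x ((le_max_left _ _).trans h)).le.trans (hmax ⟨hx₁, hx₁R⟩)

theorem integrable_rpow (hf : IsH1HalfLine f g) {p : ℝ} (hp : 2 < p) :
    IntegrableOn (fun x => |f x| ^ p) (Ici 0) := by
  obtain ⟨x₀, -, h⟩ := hf.exists_max
  exact integrable_abs_rpow hp measurableSet_Ici hf.memLp_val fun x hx => h x hx

theorem integral_mul (hf : IsH1HalfLine f g) (hh : IsH1HalfLine h k) :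
    ∫ x in Ici 0, (g x * h x + f x * k x) = - (f 0 * h 0) := by
  have hint : IntegrableOn (fun x => g x * h x + f x * k x) (Ioi 0) :=
    (((hf.memLp_grad.integrable_mul hh.memLp_val).add
      (hf.memLp_val.integrable_mul hh.memLp_grad)).mono_measure
        (Measure.restrict_mono Ioi_subset_Ici_self le_rfl))
  have h1 := intervalIntegral_tendsto_integral_Ioi 0 hint tendsto_id
  have h2 : Tendsto (fun b => f b * h b - f 0 * h 0) atTop (𝓝 (0 * 0 - f 0 * h 0)) :=
    (hf.tendsto_zero.mul hh.tendsto_zero).sub_const _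
  rw [integral_Ici_eq_integral_Ioi]
  have h3 : Tendsto (fun b => f b * h b - f 0 * h 0) atTop
      (𝓝 (∫ x in Ioi 0, (g x * h x + f x * k x))) := by
    refine h1.congr' ?_
    filter_upwards [eventually_ge_atTop 0] with x hx
    rw [id, (hf.isPrim hx).integral_mul (hh.isPrim hx)]
  rw [tendsto_nhds_unique h3 h2]
  ring

end IsH1HalfLine

/-! ### The soliton -/

theorem memLp_two_of_abs_le_exp {f : ℝ → ℝ} (hf : Continuous f) {C : ℝ}
    (hC : ∀ x, |f x| ≤ C * Real.exp (-x)) : MemLp f 2 (volume.restrict (Ici 0)) := by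
  rw [memLp_two_iff_integrable_sq hf.aestronglyMeasurable]
  have h1 : IntegrableOn (fun x : ℝ => Real.exp (-2 * x)) (Ici 0) := by
    rw [integrableOn_Ici_iff_integrableOn_Ioi]
    exact exp_neg_integrableOn_Ioi 0 (by norm_num)
  refine (h1.const_mul (C ^ 2)).mono' (by fun_prop) (Eventually.of_forall fun x => ?_)
  rw [Real.norm_of_nonneg (sq_nonneg _), ← sq_abs]
  calc |f x| ^ 2 ≤ (C * Real.exp (-x)) ^ 2 := by gcongr; exact hC x
    _ = C ^ 2 * Real.exp (-2 * x) := by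
      rw [mul_pow, ← Real.exp_nat_mul]; ring_nf

/-- The height of the soliton. -/
noncomputable def height (p : ℝ) : ℝ := (p / 2) ^ (1 / (p - 2))

/-- The derivative of the soliton. -/
noncomputable def dsoliton (p x : ℝ) : ℝ :=
  -(soliton p x * (Real.sinh ((p - 2) / 2 * x) / Real.cosh ((p - 2) / 2 * x)))

/-- The quadratic part minus the nonlinear part of (twice) the energy density. -/
noncomputable def quad (p t : ℝ) : ℝ := t ^ 2 - 2 / p * |t| ^ p

section Soliton

variable {p : ℝ}

theorem height_pos (hp : 2 < p) : 0 < height p := Real.rpow_pos_of_pos (by linarith) _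

theorem one_lt_height (hp : 2 < p) : 1 < height p :=
  Real.one_lt_rpow (by linarith) (one_div_pos.2 (by linarith))

theorem height_rpow (hp : 2 < p) : height p ^ (p - 2) = p / 2 := by
  rw [height, ← Real.rpow_mul (by linarith), one_div_mul_cancel (by linarith), Real.rpow_one]

theorem soliton_pos (hp : 2 < p) (x : ℝ) : 0 < soliton p x :=
  mul_pos (height_pos hp) (Real.rpow_pos_of_pos (one_div_pos.2 (Real.cosh_pos _)) _)

theorem soliton_zero : soliton p 0 = height p := by simp [soliton, height]

theorem soliton_neg (x : ℝ) : soliton p (-x) = soliton p x := by simp [soliton]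

theorem dsoliton_neg (x : ℝ) : dsoliton p (-x) = -dsoliton p x := by
  simp [dsoliton, soliton_neg]; ring

theorem dsoliton_zero : dsoliton p 0 = 0 := by simp [dsoliton]

theorem soliton_rpow (hp : 2 < p) (x : ℝ) :
    soliton p x ^ (p - 2) = p / 2 * (1 / Real.cosh ((p - 2) / 2 * x)) ^ 2 := by
  have hc : 0 < 1 / Real.cosh ((p - 2) / 2 * x) := one_div_pos.2 (Real.cosh_pos _)
  rw [soliton, ← height, Real.mul_rpow (height_pos hp).le (Real.rpow_pos_of_pos hc _).le, ← Real.rpow_mul hc.le]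
  congr 1
  · exact height_rpow hp
  · rw [div_mul_cancel₀ _ (by linarith)]
    exact Real.rpow_two _

theorem rpow_sub_one_eq {t : ℝ} (ht : 0 < t) : t ^ (p - 1) = t ^ (p - 2) * t := by
  nth_rw 3 [← Real.rpow_one t]
  rw [← Real.rpow_add ht]; congr 1; ring

theorem rpow_eq_mul_sq {t : ℝ} (ht : 0 < t) : t ^ p = t ^ (p - 2) * t ^ 2 := by
  rw [← Real.rpow_two, ← Real.rpow_add ht]; congr 1; ring

theorem hasDerivAt_soliton (hp : 2 < p) (x : ℝ) :
    HasDerivAt (soliton p) (dsoliton p x) x := by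
  set a := (p - 2) / 2 with ha
  have ha0 : 0 < a := by rw [ha]; linarith
  have hc : 0 < Real.cosh (a * x) := Real.cosh_pos _
  have h1 : HasDerivAt (fun x => Real.cosh (a * x)) (Real.sinh (a * x) * (a * 1)) x :=
    ((hasDerivAt_id x).const_mul a).cosh
  have h2 := ((h1.inv hc.ne').rpow_const (p := 2 / (p - 2)) (Or.inl (inv_pos.2 hc).ne')).const_mul
    (height p)
  have h3 : HasDerivAt (soliton p) _ x := h2.congr_of_eventuallyEq
    (Eventually.of_forall fun y => by simp [soliton, height, ← ha])
  convert! h3 using 1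
  have hi : 0 < (Real.cosh (a * x))⁻¹ := inv_pos.2 hc
  have h4 : ((fun x => Real.cosh (a * x))⁻¹ x) = (Real.cosh (a * x))⁻¹ := rfl
  rw [dsoliton, soliton, ← ha, ← height, one_div, h4, Real.rpow_sub_one hi.ne']
  have : 2 / (p - 2) = 1 / a := by rw [ha]; field_simp
  rw [this]
  field_simp

theorem hasDerivAt_dsoliton (hp : 2 < p) (x : ℝ) :
    HasDerivAt (dsoliton p) (soliton p x - soliton p x ^ (p - 1)) x := by
  set a := (p - 2) / 2 with ha
  have hc : 0 < Real.cosh (a * x) := Real.cosh_pos _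
  have h1 : HasDerivAt (fun x => Real.cosh (a * x)) (Real.sinh (a * x) * (a * 1)) x :=
    ((hasDerivAt_id x).const_mul a).cosh
  have h2 : HasDerivAt (fun x => Real.sinh (a * x)) (Real.cosh (a * x) * (a * 1)) x :=
    ((hasDerivAt_id x).const_mul a).sinh
  have h3 := ((hasDerivAt_soliton hp x).mul (h2.div h1 hc.ne')).neg
  convert! h3 using 1
  rw [rpow_sub_one_eq (soliton_pos hp x), soliton_rpow hp, dsoliton, ← ha]
  have h4 := Real.cosh_sq (a * x)
  have h5 : p = 2 * a + 2 := by rw [ha]; ring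
  rw [h5]
  simp only [Pi.div_apply]
  field_simp
  have h6 : Real.sinh (a * x) ^ 2 = Real.cosh (a * x) ^ 2 - 1 := by rw [h4]; ring
  ring_nf
  rw [h6]
  ring

/-- The soliton lies on the zero level of the conserved quantity `u'^2 - quad p u`. This makes it
the equality case of the calibration, and it also fixes its slope at the vertex. -/
theorem dsoliton_sq (hp : 2 < p) (x : ℝ) : dsoliton p x ^ 2 = quad p (soliton p x) := by
  have h0 := soliton_pos hp x
  rw [quad, abs_of_pos h0, rpow_eq_mul_sq h0, soliton_rpow hp, dsoliton]
  have h4 := Real.cosh_sq ((p - 2) / 2 * x)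
  have hc : 0 < Real.cosh ((p - 2) / 2 * x) := Real.cosh_pos _
  have : p ≠ 0 := by linarith
  have h6 : Real.sinh ((p - 2) / 2 * x) ^ 2 = Real.cosh ((p - 2) / 2 * x) ^ 2 - 1 := by
    rw [h4]; ring
  rw [neg_sq, mul_pow, div_pow, h6]
  field_simp

theorem dsoliton_neg_of_pos (hp : 2 < p) {x : ℝ} (hx : 0 < x) : dsoliton p x < 0 := by
  have : 0 < (p - 2) / 2 * x := by apply mul_pos <;> linarith
  exact neg_neg_of_pos (mul_pos (soliton_pos hp x)
    (div_pos (Real.sinh_pos_iff.2 this) (Real.cosh_pos _)))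

theorem continuous_soliton (hp : 2 < p) : Continuous (soliton p) :=
  continuous_iff_continuousAt.2 fun x => (hasDerivAt_soliton hp x).continuousAt

theorem continuous_dsoliton (hp : 2 < p) : Continuous (dsoliton p) :=
  continuous_iff_continuousAt.2 fun x => (hasDerivAt_dsoliton hp x).continuousAt

theorem soliton_le_height (hp : 2 < p) (x : ℝ) : soliton p x ≤ height p := by
  refine mul_le_of_le_one_right (height_pos hp).le (Real.rpow_le_one ?_ ?_ ?_)
  · exact (one_div_pos.2 (Real.cosh_pos _)).le
  · rw [div_le_one (Real.cosh_pos _)]; exact Real.one_le_cosh _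
  · exact div_nonneg zero_le_two (by linarith)

theorem soliton_le_exp (hp : 2 < p) (x : ℝ) :
    soliton p x ≤ height p * 2 ^ (2 / (p - 2)) * Real.exp (-x) := by
  rw [soliton, ← height, mul_assoc]
  refine mul_le_mul_of_nonneg_left ?_ (height_pos hp).le
  have h1 : 1 / Real.cosh ((p - 2) / 2 * x) ≤ 2 * Real.exp (-((p - 2) / 2 * x)) := by
    rw [div_le_iff₀ (Real.cosh_pos _), Real.cosh_eq]
    have := Real.exp_pos (-((p - 2) / 2 * x))
    have h2 : Real.exp (-((p - 2) / 2 * x)) * Real.exp ((p - 2) / 2 * x) = 1 := by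
      rw [← Real.exp_add]; simp
    nlinarith
  refine (Real.rpow_le_rpow (one_div_pos.2 (Real.cosh_pos _)).le h1
    (div_nonneg zero_le_two (by linarith))).trans ?_
  rw [Real.mul_rpow zero_le_two (Real.exp_pos _).le, ← Real.exp_mul]
  have : -((p - 2) / 2 * x) * (2 / (p - 2)) = -x := by
    have : p - 2 ≠ 0 := by linarith
    field_simp
  rw [this]

theorem abs_dsoliton_le (hp : 2 < p) (x : ℝ) : |dsoliton p x| ≤ soliton p x := by
  refine abs_le_of_sq_le_sq ?_ (soliton_pos hp x).le
  rw [dsoliton_sq hp, quad]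
  have : 0 ≤ 2 / p * |soliton p x| ^ p := by positivity
  linarith

theorem abs_ddsoliton_le (hp : 2 < p) (x : ℝ) :
    |soliton p x - soliton p x ^ (p - 1)| ≤ (1 + p / 2) * soliton p x := by
  have h0 := soliton_pos hp x
  have h1 : soliton p x ^ (p - 2) ≤ p / 2 := by
    rw [← height_rpow hp]
    exact Real.rpow_le_rpow h0.le (soliton_le_height hp x) (by linarith)
  have h2 : 0 < soliton p x ^ (p - 2) := Real.rpow_pos_of_pos h0 _
  rw [rpow_sub_one_eq h0, abs_le]
  constructor <;> nlinarith

theorem tendsto_soliton (hp : 2 < p) : Tendsto (soliton p) atTop (𝓝 0) := by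
  have h1 : Tendsto (fun x : ℝ => height p * 2 ^ (2 / (p - 2)) * Real.exp (-x)) atTop
      (𝓝 (height p * 2 ^ (2 / (p - 2)) * 0)) :=
    (Real.tendsto_exp_neg_atTop_nhds_zero).const_mul _
  rw [mul_zero] at h1
  exact squeeze_zero (fun x => (soliton_pos hp x).le) (soliton_le_exp hp) h1

theorem memLp_shift {F : ℝ → ℝ} {K : ℝ} (hp : 2 < p) (hF : Continuous F) (hK : 0 ≤ K)
    (h : ∀ x, |F x| ≤ K * soliton p x) (y : ℝ) :
    MemLp (fun x => F (x + y)) 2 (volume.restrict (Ici 0)) := by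
  refine memLp_two_of_abs_le_exp (by fun_prop)
    (C := K * (height p * 2 ^ (2 / (p - 2)) * Real.exp (-y))) fun x => (h _).trans ?_
  rw [mul_assoc]
  refine mul_le_mul_of_nonneg_left ((soliton_le_exp hp _).trans_eq ?_) hK
  rw [neg_add, Real.exp_add]; ring

theorem isH1HalfLine_soliton (hp : 2 < p) (y : ℝ) :
    IsH1HalfLine (fun x => soliton p (x + y)) (fun x => dsoliton p (x + y)) := by
  refine ⟨memLp_shift hp (continuous_soliton hp) zero_le_one (fun x => ?_) y,
    memLp_shift hp (continuous_dsoliton hp) zero_le_one (fun x => ?_) y, fun x hx => ?_⟩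
  · rw [abs_of_pos (soliton_pos hp x), one_mul]
  · rw [one_mul]; exact abs_dsoliton_le hp x
  · rw [intervalIntegral.integral_eq_sub_of_hasDerivAt
      (fun t _ => (hasDerivAt_soliton hp (t + y)).comp_add_const t y)
      (Continuous.intervalIntegrable ((continuous_dsoliton hp).comp (by fun_prop)) _ _)]
    ring

theorem isH1HalfLine_dsoliton (hp : 2 < p) (y : ℝ) :
    IsH1HalfLine (fun x => dsoliton p (x + y))
      (fun x => soliton p (x + y) - soliton p (x + y) ^ (p - 1)) := by
  have hc : Continuous fun x => soliton p x - soliton p x ^ (p - 1) :=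
    (continuous_soliton hp).sub ((continuous_soliton hp).rpow_const
      fun x => Or.inl (soliton_pos hp x).ne')
  refine ⟨memLp_shift hp (continuous_dsoliton hp) zero_le_one (fun x => ?_) y,
    memLp_shift hp hc (by linarith : 0 ≤ 1 + p / 2) (abs_ddsoliton_le hp) y, fun x hx => ?_⟩
  · rw [one_mul]; exact abs_dsoliton_le hp x
  · rw [intervalIntegral.integral_eq_sub_of_hasDerivAt
      (fun t _ => (hasDerivAt_dsoliton hp (t + y)).comp_add_const t y)
      (Continuous.intervalIntegrable (hc.comp (continuous_add_const y)) _ _)]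
    ring

end Soliton

/-! ### Calibration of the action -/

section Calibration

variable {p : ℝ}

theorem continuous_quad (hp : 2 < p) : Continuous (quad p) :=
  (continuous_pow 2).sub (continuous_const.mul
    (continuous_abs.rpow_const fun _ => Or.inr (by linarith)))

theorem quad_eq_mul (hp : 2 < p) (t : ℝ) : quad p t = t ^ 2 * (1 - 2 / p * |t| ^ (p - 2)) := by
  rcases eq_or_ne t 0 with rfl | h
  · simp [quad, Real.zero_rpow (by linarith : p ≠ 0)]
  · rw [quad, rpow_eq_mul_sq (abs_pos.2 h), sq_abs]; ring

theorem quad_neg (t : ℝ) : quad p (-t) = quad p t := by simp [quad]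

theorem quad_nonneg (hp : 2 < p) {t : ℝ} (ht : |t| ≤ height p) : 0 ≤ quad p t := by
  rw [quad_eq_mul hp]
  have h1 : |t| ^ (p - 2) ≤ p / 2 := by
    rw [← height_rpow hp]
    exact Real.rpow_le_rpow (abs_nonneg _) ht (by linarith)
  refine mul_nonneg (sq_nonneg _) (sub_nonneg.2 ?_)
  calc 2 / p * |t| ^ (p - 2) ≤ 2 / p * (p / 2) := by gcongr
    _ = 1 := by field_simp

theorem quad_pos (hp : 2 < p) {t : ℝ} (h0 : 0 < t) (ht : t < height p) : 0 < quad p t := by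
  rw [quad_eq_mul hp, abs_of_pos h0]
  have h1 : t ^ (p - 2) < p / 2 := by
    rw [← height_rpow hp]
    exact Real.rpow_lt_rpow h0.le ht (by linarith)
  refine mul_pos (by positivity) (sub_pos.2 ?_)
  calc 2 / p * t ^ (p - 2) < 2 / p * (p / 2) := by gcongr
    _ = 1 := by field_simp

theorem neg_le_quad (hp : 2 < p) {t B : ℝ} (ht : |t| ≤ B) : -(B ^ p) ≤ quad p t := by
  have h1 : |t| ^ p ≤ B ^ p := Real.rpow_le_rpow (abs_nonneg _) ht (by linarith)
  have h2 : 2 / p ≤ 1 := (div_le_one (by linarith)).2 hp.le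
  have h3 : 0 ≤ |t| ^ p := by positivity
  rw [quad]
  nlinarith [sq_nonneg t]

/-- The speed on the zero-energy level. -/
noncomputable def speed (p t : ℝ) : ℝ := √(quad p t)

theorem continuous_speed (hp : 2 < p) : Continuous (speed p) := (continuous_quad hp).sqrt

theorem speed_nonneg (t : ℝ) : 0 ≤ speed p t := Real.sqrt_nonneg _

theorem speed_neg (t : ℝ) : speed p (-t) = speed p t := by rw [speed, quad_neg, speed]

theorem speed_sq (hp : 2 < p) {t : ℝ} (ht : |t| ≤ height p) : speed p t ^ 2 = quad p t :=
  Real.sq_sqrt (quad_nonneg hp ht)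

theorem speed_le (t : ℝ) (hp : 2 < p) : speed p t ≤ |t| := by
  rw [speed, ← Real.sqrt_sq_eq_abs]
  refine Real.sqrt_le_sqrt ?_
  have : 0 ≤ 2 / p * |t| ^ p := by positivity
  rw [quad]; linarith

/-- The primitive of the speed: the least cost of the transition from `0` to `v`. -/
noncomputable def cost (p v : ℝ) : ℝ := ∫ t in (0 : ℝ)..v, speed p t

theorem hasDerivAt_cost (hp : 2 < p) (v : ℝ) : HasDerivAt (cost p) (speed p v) v :=
  intervalIntegral.integral_hasDerivAt_right ((continuous_speed hp).intervalIntegrable _ _)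
    ((continuous_speed hp).stronglyMeasurableAtFilter _ _) (continuous_speed hp).continuousAt

theorem continuous_cost (hp : 2 < p) : Continuous (cost p) :=
  continuous_iff_continuousAt.2 fun x => (hasDerivAt_cost hp x).continuousAt

/-- No bound on the argument is needed: where `quad` is negative, the square root takes its default
value `0` and `cost` is constant. -/
theorem monotone_cost (hp : 2 < p) : Monotone (cost p) :=
  monotone_of_deriv_nonneg (fun x => (hasDerivAt_cost hp x).differentiableAt) fun x => by
    rw [(hasDerivAt_cost hp x).deriv]; exact speed_nonneg x

theorem cost_zero : cost p 0 = 0 := by simp [cost]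

theorem cost_neg (v : ℝ) : cost p (-v) = -cost p v := by
  have h := intervalIntegral.integral_comp_neg (a := 0) (b := v) (fun t => speed p t)
  simp only [speed_neg, neg_zero] at h
  rw [cost, cost, h, intervalIntegral.integral_symm]

theorem abs_cost (hp : 2 < p) (v : ℝ) : |cost p v| = cost p |v| := by
  have h0 : 0 ≤ cost p |v| := by
    rw [← cost_zero (p := p)]; exact monotone_cost hp (abs_nonneg v)
  rcases abs_choice v with h | h
  · rw [h] at h0 ⊢; exact abs_of_nonneg h0
  · rw [h] at h0 ⊢
    rw [cost_neg] at h0 ⊢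
    exact abs_of_nonpos (by linarith)

theorem cost_pos (hp : 2 < p) {v : ℝ} (h0 : 0 < v) (hv : v ≤ height p) : 0 < cost p v :=
  intervalIntegral.intervalIntegral_pos_of_pos_on ((continuous_speed hp).intervalIntegrable _ _)
    (fun _ hx => Real.sqrt_pos.2 (quad_pos hp hx.1 (hx.2.trans_le hv))) h0

variable {f g : ℝ → ℝ} {a b : ℝ}

theorem intervalIntegrable_density (hp : 2 < p) (hf : IsPrim f g a b)
    (hg : IntervalIntegrable (fun x => g x ^ 2) volume a b) :
    IntervalIntegrable (fun x => g x ^ 2 + quad p (f x)) volume a b :=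
  hg.add (((continuous_quad hp).comp_continuousOn
    (by simpa [uIcc_of_le hf.le] using hf.continuousOn)).intervalIntegrable)

/-- Complete the square: `g² + quad f = (g - speed f)² + 2 speed f · g`, and the last term is the
derivative of `2 cost ∘ f`. The bound on `f` ensures `speed² = quad`. -/
theorem cost_sub_add_integral_sq (hp : 2 < p) (hf : IsPrim f g a b)
    (hg : IntervalIntegrable (fun x => g x ^ 2) volume a b)
    (hS : ∀ x ∈ Icc a b, |f x| ≤ height p) :
    IntervalIntegrable (fun x => (g x - speed p (f x)) ^ 2) volume a b ∧
    ∫ x in a..b, (g x ^ 2 + quad p (f x)) =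
      2 * (cost p (f b) - cost p (f a)) + ∫ x in a..b, (g x - speed p (f x)) ^ 2 := by
  have hfc : ContinuousOn f (uIcc a b) := by simpa [uIcc_of_le hf.le] using hf.continuousOn
  have hi : IntervalIntegrable (fun x => speed p (f x) * g x) volume a b :=
    hf.int.continuousOn_mul ((continuous_speed hp).comp_continuousOn hfc)
  have hd := intervalIntegrable_density hp hf hg
  have he : EqOn (fun x => (g x ^ 2 + quad p (f x)) - 2 * (speed p (f x) * g x))
      (fun x => (g x - speed p (f x)) ^ 2) (uIcc a b) := fun x hx => by
    rw [uIcc_of_le hf.le] at hx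
    simp only [← speed_sq hp (hS x hx)]; ring
  have hs := hd.sub (hi.const_mul 2)
  refine ⟨(hs.congr (he.mono uIoc_subset_uIcc)), ?_⟩
  rw [← intervalIntegral.integral_congr he, intervalIntegral.integral_sub hd (hi.const_mul 2),
    intervalIntegral.integral_const_mul, hf.integral_comp (hasDerivAt_cost hp) (continuous_speed hp)]
  ring

theorem two_mul_cost_sub_le (hp : 2 < p) (hf : IsPrim f g a b)
    (hg : IntervalIntegrable (fun x => g x ^ 2) volume a b)
    (hS : ∀ x ∈ Icc a b, |f x| ≤ height p) :
    2 * (cost p (f b) - cost p (f a)) ≤ ∫ x in a..b, (g x ^ 2 + quad p (f x)) := by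
  rw [(cost_sub_add_integral_sq hp hf hg hS).2]
  have : 0 ≤ ∫ x in a..b, (g x - speed p (f x)) ^ 2 :=
    intervalIntegral.integral_nonneg hf.le fun x _ => sq_nonneg _
  linarith

theorem IsPrim.neg (hf : IsPrim f g a b) : IsPrim (fun x => -f x) (fun x => -g x) a b :=
  ⟨hf.le, hf.int.neg, fun x hx => by rw [hf.eq x hx, intervalIntegral.integral_neg]; ring⟩

theorem two_mul_abs_cost_sub_le (hp : 2 < p) (hf : IsPrim f g a b)
    (hg : IntervalIntegrable (fun x => g x ^ 2) volume a b)
    (hS : ∀ x ∈ Icc a b, |f x| ≤ height p) :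
    2 * |cost p (f b) - cost p (f a)| ≤ ∫ x in a..b, (g x ^ 2 + quad p (f x)) := by
  have h1 := two_mul_cost_sub_le hp hf hg hS
  have h2 := two_mul_cost_sub_le hp hf.neg (by simpa using hg) (by simpa using hS)
  simp only [neg_sq, quad_neg, cost_neg] at h2
  rcases abs_choice (cost p (f b) - cost p (f a)) with h | h <;> rw [h] <;> linarith

/-- Equality would force `f' = speed f`. As `speed t ≤ |t|`, Grönwall's inequality would keep `f` at
its initial value `0`: the zero state cannot be left at optimal cost in finite time. -/
theorem two_mul_cost_lt (hp : 2 < p) (hf : IsPrim f g a b)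
    (hg : IntervalIntegrable (fun x => g x ^ 2) volume a b)
    (hS : ∀ x ∈ Icc a b, |f x| ≤ height p) (ha : f a = 0) (hb : f b ≠ 0) :
    2 * cost p (f b) < ∫ x in a..b, (g x ^ 2 + quad p (f x)) := by
  obtain ⟨hi, he⟩ := cost_sub_add_integral_sq hp hf hg hS
  rw [he, ha, cost_zero, sub_zero, lt_add_iff_pos_right]
  refine lt_of_le_of_ne (intervalIntegral.integral_nonneg hf.le fun x _ => sq_nonneg _) fun h => hb ?_
  have hae := (intervalIntegral.integral_eq_zero_iff_of_le_of_nonneg_ae hf.le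
    (Eventually.of_forall fun x => sq_nonneg _) hi).1 h.symm
  have hae' : ∀ᵐ x, x ∈ Ioc a b → g x = speed p (f x) := by
    rw [← ae_restrict_iff' measurableSet_Ioc]
    filter_upwards [hae] with x hx
    exact sub_eq_zero.1 (pow_eq_zero_iff two_ne_zero |>.1 hx)
  have hfc : ContinuousOn (fun x => speed p (f x)) (Icc a b) :=
    (continuous_speed hp).comp_continuousOn hf.continuousOn
  have hint : ∀ x ∈ Icc a b, f x = ∫ t in a..x, speed p (f t) := fun x hx => by
    rw [hf.eq x hx, ha, zero_add]
    refine intervalIntegral.integral_congr_ae ?_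
    filter_upwards [hae'] with t ht hmem
    rw [uIoc_of_le hx.1] at hmem
    exact ht ⟨hmem.1, hmem.2.trans hx.2⟩
  -- Since `f` is now the integral of a continuous function, the almost-everywhere equation holds at
  -- every point from the right, as Grönwall requires.
  have hder : ∀ x ∈ Ico a b, HasDerivWithinAt f (speed p (f x)) (Ici x) x := fun x hx => by
    have h1 : HasDerivWithinAt (fun x => ∫ t in a..x, speed p (f t)) (speed p (f x)) (Icc a b) x :=
      have : Fact (x ∈ Icc a b) := ⟨Ico_subset_Icc_self hx⟩
      intervalIntegral.integral_hasDerivWithinAt_right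
        ((hfc.mono (Icc_subset_Icc le_rfl hx.2.le)).intervalIntegrable_of_Icc hx.1)
        (hfc.stronglyMeasurableAtFilter_nhdsWithin measurableSet_Icc x)
        (hfc x (Ico_subset_Icc_self hx))
    have h2 := h1.congr (fun y hy => hint y hy) (hint x (Ico_subset_Icc_self hx))
    refine (h2.mono (Icc_subset_Icc hx.1 le_rfl : Icc x b ⊆ _)).mono_of_mem_nhdsWithin ?_
    exact Icc_mem_nhdsGE hx.2
  exact eq_zero_of_abs_deriv_le_mul_abs_self_of_eq_zero_right (K := 1) hf.continuousOn hder ha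
    (fun x _ => by
      rw [one_mul, Real.norm_of_nonneg (speed_nonneg _)]; exact speed_le _ hp) b ⟨hf.le, le_rfl⟩

namespace IsH1HalfLine

theorem intervalIntegrable_sq (hf : IsH1HalfLine f g) (ha : 0 ≤ a) (hab : a ≤ b) :
    IntervalIntegrable (fun x => g x ^ 2) volume a b := by
  rw [intervalIntegrable_iff_integrableOn_Icc_of_le hab]
  exact hf.integrable_sq_grad.mono_set (Icc_subset_Ici_self.trans (Ici_subset_Ici.2 ha))

theorem integrable_density (hf : IsH1HalfLine f g) (hp : 2 < p) :
    IntegrableOn (fun x => g x ^ 2 + quad p (f x)) (Ici 0) :=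
  hf.integrable_sq_grad.add (hf.integrable_sq_val.sub ((hf.integrable_rpow hp).const_mul (2 / p)))

theorem two_mul_cost_le_tail (hf : IsH1HalfLine f g) (hp : 2 < p) (ha : 0 ≤ a)
    (hS : ∀ x, 0 ≤ x → |f x| ≤ height p) :
    2 * cost p |f a| ≤ ∫ x in Ioi a, (g x ^ 2 + quad p (f x)) := by
  have h1 := intervalIntegral_tendsto_integral_Ioi a ((hf.integrable_density hp).mono_set
    ((Ioi_subset_Ici_self).trans (Ici_subset_Ici.2 ha))) tendsto_id
  have h2 : Tendsto (fun b => 2 * |cost p (f b) - cost p (f a)|) atTop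
      (𝓝 (2 * |cost p 0 - cost p (f a)|)) :=
    ((((continuous_cost hp).tendsto 0).comp hf.tendsto_zero).sub_const _).abs.const_mul 2
  rw [cost_zero, zero_sub, abs_neg, abs_cost hp] at h2
  refine le_of_tendsto_of_tendsto h2 h1 ?_
  filter_upwards [eventually_ge_atTop a] with b hb
  exact two_mul_abs_cost_sub_le hp (hf.isPrim' ha hb) (hf.intervalIntegrable_sq ha hb)
    fun x hx => hS x (ha.trans hx.1)

theorem two_mul_cost_le (hf : IsH1HalfLine f g) (hp : 2 < p)
    (hS : ∀ x, 0 ≤ x → |f x| ≤ height p) :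
    2 * cost p |f 0| ≤ ∫ x in Ici 0, (g x ^ 2 + quad p (f x)) := by
  rw [integral_Ici_eq_integral_Ioi]
  exact hf.two_mul_cost_le_tail hp le_rfl hS

theorem integral_density_eq (hf : IsH1HalfLine f g) (hp : 2 < p) (ha : 0 ≤ a) :
    ∫ x in Ici 0, (g x ^ 2 + quad p (f x)) =
      (∫ x in (0 : ℝ)..a, (g x ^ 2 + quad p (f x))) + ∫ x in Ioi a, (g x ^ 2 + quad p (f x)) := by
  rw [integral_Ici_eq_integral_Ioi, intervalIntegral.integral_of_le ha,
    ← setIntegral_union Ioc_disjoint_Ioi_same measurableSet_Ioi, Ioc_union_Ioi_eq_Ioi ha]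
  · exact (hf.integrable_density hp).mono_set (Ioc_subset_Ioi_self.trans Ioi_subset_Ici_self)
  · exact (hf.integrable_density hp).mono_set (Ioi_subset_Ici_self.trans (Ici_subset_Ici.2 ha))

/-- The climb from `f 0` to the height costs `2 (cost S - cost (f 0))`, and the descent to `0` at
infinity costs `2 cost S`. -/
theorem cost_le_of_eq_height (hf : IsH1HalfLine f g) (hp : 2 < p) (ha : 0 ≤ a)
    (hS : ∀ x, 0 ≤ x → |f x| ≤ height p) (hfa : f a = height p) :
    4 * cost p (height p) - 2 * cost p |f 0| ≤ ∫ x in Ici 0, (g x ^ 2 + quad p (f x)) := by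
  have h1 := hf.two_mul_cost_le_tail hp ha hS
  have h2 := two_mul_cost_sub_le hp (hf.isPrim ha) (hf.intervalIntegrable_sq le_rfl ha)
    fun x hx => hS x hx.1
  rw [hf.integral_density_eq hp ha]
  rw [hfa] at h1 h2
  rw [abs_of_pos (height_pos hp)] at h1
  have h3 := monotone_cost hp (le_abs_self (f 0))
  linarith

theorem cost_lt_of_eq_height (hf : IsH1HalfLine f g) (hp : 2 < p) (ha : 0 ≤ a)
    (hS : ∀ x, 0 ≤ x → |f x| ≤ height p) (hfa : f a = height p) (h0 : f 0 = 0) :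
    4 * cost p (height p) < ∫ x in Ici 0, (g x ^ 2 + quad p (f x)) := by
  have h1 := hf.two_mul_cost_le_tail hp ha hS
  have h2 := two_mul_cost_lt hp (hf.isPrim ha) (hf.intervalIntegrable_sq le_rfl ha)
    (fun x hx => hS x hx.1) h0 (by rw [hfa]; exact (height_pos hp).ne')
  rw [hf.integral_density_eq hp ha]
  rw [hfa] at h1 h2
  rw [abs_of_pos (height_pos hp)] at h1
  linarith

end IsH1HalfLine

/-- Cauchy–Schwarz, by comparison with the constant slope `c`: integrate `g² ≥ 2 c g - c²` over `[0,
x]`. -/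
theorem sq_sub_div_le {x : ℝ} (hf : IsPrim f g 0 b)
    (hg : IntervalIntegrable (fun x => g x ^ 2) volume 0 b) (hb : 0 < b) (hx : x ∈ Icc 0 b) :
    (f x - f 0) ^ 2 / b ≤ ∫ t in (0 : ℝ)..b, g t ^ 2 := by
  set c := (f x - f 0) / b with hc
  have hg' : IntervalIntegrable (fun x => g x ^ 2) volume 0 x := hg.mono_set (by
    rw [uIcc_of_le hx.1, uIcc_of_le hb.le]; exact Icc_subset_Icc le_rfl hx.2)
  have hp := hf.mono le_rfl hx.1 hx.2
  have h1 : ∫ t in (0 : ℝ)..x, (2 * c * g t - c ^ 2) ≤ ∫ t in (0 : ℝ)..x, g t ^ 2 := by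
    refine intervalIntegral.integral_mono_on hx.1 ((hp.int.const_mul _).sub
      intervalIntegrable_const) hg' fun t _ => ?_
    nlinarith [sq_nonneg (g t - c)]
  rw [intervalIntegral.integral_sub (hp.int.const_mul _) intervalIntegrable_const,
    intervalIntegral.integral_const_mul, ← hf.sub_eq le_rfl hx.1 hx.2,
    intervalIntegral.integral_const] at h1
  have h2 : ∫ t in (0 : ℝ)..x, g t ^ 2 ≤ ∫ t in (0 : ℝ)..b, g t ^ 2 :=
    intervalIntegral.integral_mono_interval le_rfl hx.1 hx.2
      (Eventually.of_forall fun t => sq_nonneg _) hg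
  have h3 : f x - f 0 = c * b := by rw [hc]; field_simp
  simp only [sub_zero, smul_eq_mul] at h1
  rw [h3] at h1 ⊢
  have h4 : (c * b) ^ 2 / b = c ^ 2 * b := by field_simp
  rw [h4]
  nlinarith [mul_le_mul_of_nonneg_right hx.2 (sq_nonneg c)]

end Calibration

/-! ### Lower bound for the action on the broom -/

theorem graphIntegral_eq {H : ℕ} (ℓ : ℝ) (F : Edge H → ℝ → ℝ) :
    graphIntegral ℓ F =
      (∫ x in Icc 0 ℓ, F none x) + ∑ h : Fin H, ∫ x in Ici 0, F (some h) x := by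
  rw [graphIntegral, Fintype.sum_option]; rfl

namespace H1

variable {H : ℕ} {ℓ p : ℝ}

theorem isH1HalfLine (u : H1 H ℓ) (h : Fin H) : IsH1HalfLine (u.val (some h)) (u.grad (some h)) :=
  ⟨u.memLp_val (some h), u.memLp_grad (some h), fun x hx => u.val_eq (some h) x hx⟩

theorem isPrim (u : H1 H ℓ) (hℓ : 0 ≤ ℓ) : IsPrim (u.val none) (u.grad none) 0 ℓ := by
  refine ⟨hℓ, ?_, fun x hx => u.val_eq none x hx⟩
  rw [intervalIntegrable_iff_integrableOn_Icc_of_le hℓ]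
  have h1 : MemLp (u.grad none) 2 (volume.restrict (Icc 0 ℓ)) := u.memLp_grad none
  exact h1.integrable (by norm_num)

theorem intervalIntegrable_sq (u : H1 H ℓ) (hℓ : 0 ≤ ℓ) :
    IntervalIntegrable (fun x => u.grad none x ^ 2) volume 0 ℓ := by
  rw [intervalIntegrable_iff_integrableOn_Icc_of_le hℓ]
  exact (u.memLp_grad none).integrable_sq

theorem integrable_rpow (u : H1 H ℓ) (hp : 2 < p) (hℓ : 0 ≤ ℓ) (e : Edge H) :
    IntegrableOn (fun x => |u.val e x| ^ p) (dom ℓ e) := by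
  cases e with
  | none =>
    obtain ⟨C, hC⟩ := isCompact_Icc.exists_bound_of_continuousOn (u.isPrim hℓ).continuousOn
    exact integrable_abs_rpow hp measurableSet_Icc (u.memLp_val none) hC
  | some h => exact (u.isH1HalfLine h).integrable_rpow hp

/-- The multiple `t u`. -/
def scale (t : ℝ) (u : H1 H ℓ) : H1 H ℓ where
  val e x := t * u.val e x
  grad e x := t * u.grad e x
  memLp_val e := (u.memLp_val e).const_mul t
  memLp_grad e := (u.memLp_grad e).const_mul t
  val_eq e x hx := by rw [u.val_eq e x hx, intervalIntegral.integral_const_mul]; ring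
  vertex e₁ e₂ := by rw [u.vertex e₁ e₂]

/-- Twice the action functional `½ ‖u'‖₂² + ½ ‖u‖₂² - (1/p) ‖u‖_p^p`. -/
noncomputable def action (p : ℝ) (u : H1 H ℓ) : ℝ :=
  graphIntegral ℓ fun e x => u.grad e x ^ 2 + quad p (u.val e x)

theorem action_scale (u : H1 H ℓ) (hp : 2 < p) (hℓ : 0 ≤ ℓ) (t : ℝ) :
    (u.scale t).action p = t ^ 2 * (2 * u.energy) -
      2 / p * |t| ^ p * graphIntegral ℓ fun e x => |u.val e x| ^ p := by
  have key : ∀ e, ∫ x in dom ℓ e, ((t * u.grad e x) ^ 2 + quad p (t * u.val e x)) =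
      t ^ 2 * (∫ x in dom ℓ e, u.grad e x ^ 2) + t ^ 2 * (∫ x in dom ℓ e, u.val e x ^ 2)
        - 2 / p * |t| ^ p * ∫ x in dom ℓ e, |u.val e x| ^ p := fun e => by
    have h1 := (u.memLp_grad e).integrable_sq.const_mul (t ^ 2)
    have h2 := (u.memLp_val e).integrable_sq.const_mul (t ^ 2)
    have h3 := (u.integrable_rpow hp hℓ e).const_mul (2 / p * |t| ^ p)
    have h12 : Integrable (fun x => t ^ 2 * u.grad e x ^ 2 + t ^ 2 * u.val e x ^ 2)
      (volume.restrict (dom ℓ e)) := h1.add h2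
    rw [← integral_const_mul, ← integral_const_mul, ← integral_const_mul, ← integral_add h1 h2,
      ← integral_sub h12 h3]
    congr 1; ext x
    rw [quad, abs_mul, Real.mul_rpow (abs_nonneg _) (abs_nonneg _)]; ring
  simp only [action, energy, graphIntegral, scale, key, Finset.sum_sub_distrib,
    Finset.sum_add_distrib, ← Finset.mul_sum]
  ring

/-- On a short pendant oscillation is expensive, and the negative part of `quad` can gain at most
the length times `(2 S)^p`. -/
theorem pendant_bounds (u : H1 H ℓ) (hp : 2 < p) (hℓ : 0 < ℓ)
    (hM : ∀ x ∈ Icc 0 ℓ, |u.val none x| ≤ 2 * height p) {x : ℝ} (hx : x ∈ Icc 0 ℓ) :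
    (u.val none x - u.val none 0) ^ 2 / ℓ - ℓ * (2 * height p) ^ p ≤
      ∫ x in Icc 0 ℓ, (u.grad none x ^ 2 + quad p (u.val none x)) := by
  have hP := u.isPrim hℓ.le
  have hi := u.intervalIntegrable_sq hℓ.le
  have hq : IntervalIntegrable (fun x => quad p (u.val none x)) volume 0 ℓ :=
    ((continuous_quad hp).comp_continuousOn
      (by simpa [uIcc_of_le hℓ.le] using hP.continuousOn)).intervalIntegrable
  rw [integral_Icc_eq_integral_Ioc, ← intervalIntegral.integral_of_le hℓ.le,
    intervalIntegral.integral_add hi hq]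
  have h1 := sq_sub_div_le hP hi hℓ hx
  have h2 : ∫ x in (0 : ℝ)..ℓ, -((2 * height p) ^ p) ≤ ∫ x in (0 : ℝ)..ℓ, quad p (u.val none x) :=
    intervalIntegral.integral_mono_on hℓ.le intervalIntegrable_const hq
      fun x hx => neg_le_quad hp (hM x hx)
  rw [intervalIntegral.integral_const, smul_eq_mul, sub_zero] at h2
  linarith

theorem pendant_nonneg (u : H1 H ℓ) (hp : 2 < p)
    (hM : ∀ x ∈ Icc 0 ℓ, |u.val none x| ≤ height p) :
    0 ≤ ∫ x in Icc 0 ℓ, (u.grad none x ^ 2 + quad p (u.val none x)) :=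
  setIntegral_nonneg measurableSet_Icc fun x hx =>
    add_nonneg (sq_nonneg _) (quad_nonneg hp (hM x hx))

theorem lt_action_of_pendant (u : H1 H ℓ) (hp : 2 < p) (hℓ : 0 < ℓ)
    (hsmall : 4 * cost p (height p) < height p ^ 2 / ℓ - ℓ * (2 * height p) ^ p)
    (hm : ∀ h : Fin H, ∀ x, 0 ≤ x → |u.val (some h) x| ≤ height p)
    (hv : |u.val none 0| ≤ height p)
    (hM : ∀ x ∈ Icc 0 ℓ, |u.val none x| ≤ 2 * height p)
    (hx : ∃ x ∈ Icc 0 ℓ, |u.val none x| = 2 * height p) :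
    4 * cost p (height p) < u.action p := by
  obtain ⟨x, hx, hval⟩ := hx
  rw [action, graphIntegral_eq]
  have h1 := u.pendant_bounds hp hℓ hM hx
  have h2 : 0 ≤ ∑ h : Fin H, ∫ x in Ici 0,
      (u.grad (some h) x ^ 2 + quad p (u.val (some h) x)) :=
    Finset.sum_nonneg fun h _ => setIntegral_nonneg measurableSet_Ici fun x hx =>
      add_nonneg (sq_nonneg _) (quad_nonneg hp (hm h x hx))
  have h3 : height p ^ 2 ≤ (u.val none x - u.val none 0) ^ 2 := by
    refine sq_le_sq' ?_ ?_ |>.trans_eq (sq_abs (u.val none x - u.val none 0))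
    · have := abs_nonneg (u.val none x - u.val none 0)
      have := height_pos hp
      linarith
    · have := abs_sub_abs_le_abs_sub (u.val none x) (u.val none 0)
      linarith
  have h4 : height p ^ 2 / ℓ ≤ (u.val none x - u.val none 0) ^ 2 / ℓ := by gcongr
  linarith

/-- The half-line reaching `S` pays `4 cost S - 2 cost |v|` and at least two others pay `2 cost |v|`
each, which leaves a surplus `2 cost |v|`. If `|v| ≥ S/2`, the surplus absorbs a negative pendant.
Otherwise the pendant contributes a nonnegative amount, since exceeding `S` means rising by `S/2`
over a short length. -/
theorem lt_action_of_halfLine (u : H1 H ℓ) (hp : 2 < p) (hH : 3 ≤ H) (hℓ : 0 < ℓ)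
    (h₁ : ℓ * (2 * height p) ^ p < 2 * cost p (height p / 2))
    (h₂ : ℓ * (2 * height p) ^ p ≤ (height p / 2) ^ 2 / ℓ)
    (hm : ∀ h : Fin H, ∀ x, 0 ≤ x → |u.val (some h) x| ≤ height p)
    (hM : ∀ x ∈ Icc 0 ℓ, |u.val none x| ≤ 2 * height p)
    (hx : ∃ h : Fin H, ∃ x, 0 ≤ x ∧ u.val (some h) x = height p) :
    4 * cost p (height p) < u.action p := by
  obtain ⟨h₀, x₀, hx₀, hval⟩ := hx
  set v := u.val none 0 with hv
  have hv' : ∀ h : Fin H, u.val (some h) 0 = v := fun h => u.vertex _ _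
  set E : Fin H → ℝ := fun h => ∫ x in Ici 0, (u.grad (some h) x ^ 2 + quad p (u.val (some h) x))
  have hc0 : 0 ≤ cost p |v| := by
    rw [← cost_zero (p := p)]; exact monotone_cost hp (abs_nonneg _)
  have hE : ∀ h, 2 * cost p |v| ≤ E h := fun h => by
    rw [← hv' h]; exact (u.isH1HalfLine h).two_mul_cost_le hp (hm h)
  have hE₀ := (u.isH1HalfLine h₀).cost_le_of_eq_height hp hx₀ (hm h₀) hval
  rw [hv' h₀] at hE₀
  have hsum : E h₀ + 4 * cost p |v| ≤ ∑ h, E h := by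
    rw [← Finset.add_sum_erase _ _ (Finset.mem_univ h₀)]
    have h1 : ∑ _h ∈ Finset.univ.erase h₀, 2 * cost p |v| ≤ ∑ h ∈ Finset.univ.erase h₀, E h :=
      Finset.sum_le_sum fun h _ => hE h
    rw [Finset.sum_const, Finset.card_erase_of_mem (Finset.mem_univ _), Finset.card_univ,
      Fintype.card_fin, nsmul_eq_mul] at h1
    have h2 : (2 : ℝ) ≤ ((H - 1 : ℕ) : ℝ) := by
      exact_mod_cast (by omega : 2 ≤ H - 1)
    nlinarith
  have hhl : 4 * cost p (height p) + 2 * cost p |v| ≤ ∑ h, E h := by linarith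
  have hS := height_pos hp
  rw [action, graphIntegral_eq]
  change _ < _ + ∑ h, E h
  rcases le_total (height p / 2) |v| with hlarge | hlow
  · have h1 := u.pendant_bounds hp hℓ hM (x := 0) ⟨le_rfl, hℓ.le⟩
    have h2 := monotone_cost hp hlarge
    rw [sub_self] at h1
    norm_num at h1
    linarith
  · have hpend : 0 ≤ ∫ x in Icc 0 ℓ, (u.grad none x ^ 2 + quad p (u.val none x)) := by
      by_cases hall : ∀ x ∈ Icc 0 ℓ, |u.val none x| ≤ height p
      · exact u.pendant_nonneg hp hall
      · push Not at hall
        obtain ⟨x, hx, hlt⟩ := hall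
        have h1 := u.pendant_bounds hp hℓ hM hx
        have h3 : (height p / 2) ^ 2 ≤ (u.val none x - u.val none 0) ^ 2 := by
          refine sq_le_sq' ?_ ?_ |>.trans_eq (sq_abs (u.val none x - u.val none 0))
          · have := abs_nonneg (u.val none x - u.val none 0)
            linarith
          · have := abs_sub_abs_le_abs_sub (u.val none x) (u.val none 0)
            linarith
        have h4 : (height p / 2) ^ 2 / ℓ ≤ (u.val none x - u.val none 0) ^ 2 / ℓ := by gcongr
        linarith
    -- For `v = 0` the surplus vanishes, and strictness comes from the half-line leaving zero in
    -- finite time.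
    rcases eq_or_ne v 0 with h0 | h0
    · have h5 := (u.isH1HalfLine h₀).cost_lt_of_eq_height hp hx₀ (hm h₀) hval (by rw [hv' h₀, h0])
      have h6 : 4 * cost p (height p) < E h₀ := h5
      linarith
    · have h5 := cost_pos hp (abs_pos.2 h0) (by linarith)
      linarith

theorem exists_pendant_max (u : H1 H ℓ) (hℓ : 0 ≤ ℓ) :
    ∃ x₀ ∈ Icc 0 ℓ, ∀ x ∈ Icc 0 ℓ, |u.val none x| ≤ |u.val none x₀| := by
  obtain ⟨x₀, hx₀, hmax⟩ := isCompact_Icc.exists_isMaxOn ⟨0, left_mem_Icc.2 hℓ⟩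
    (u.isPrim hℓ).continuousOn.abs
  exact ⟨x₀, hx₀, fun x hx => hmax hx⟩

theorem exists_halfLine_max (u : H1 H ℓ) (hH : 0 < H) :
    ∃ h₀ : Fin H, ∃ x₀, 0 ≤ x₀ ∧
      ∀ h : Fin H, ∀ x, 0 ≤ x → |u.val (some h) x| ≤ |u.val (some h₀) x₀| := by
  choose X hX0 hX using fun h => (u.isH1HalfLine h).exists_max
  have : Nonempty (Fin H) := ⟨⟨0, hH⟩⟩
  obtain ⟨h₀, hh₀⟩ := Finite.exists_max fun h => |u.val (some h) (X h)|
  exact ⟨h₀, X h₀, hX0 h₀, fun h x hx => (hX h x hx).trans (hh₀ h)⟩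

/-- The alternative is whether the pendant maximum is at least twice the half-line maximum. The
ratio `2` leaves a rise of `S` along the pendant in one case and bounds the pendant by `2 S` in the
other. -/
theorem exists_lt_action (u : H1 H ℓ) (hp : 2 < p) (hH : 3 ≤ H) (hℓ : 0 < ℓ)
    (h₀ : 4 * cost p (height p) < height p ^ 2 / ℓ - ℓ * (2 * height p) ^ p)
    (h₁ : ℓ * (2 * height p) ^ p < 2 * cost p (height p / 2))
    (h₂ : ℓ * (2 * height p) ^ p ≤ (height p / 2) ^ 2 / ℓ)
    (hu : ∃ e, ∃ x ∈ dom ℓ e, u.val e x ≠ 0) :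
    ∃ t : ℝ, t ≠ 0 ∧ 4 * cost p (height p) < (u.scale t).action p := by
  obtain ⟨xM, hxM, hM⟩ := u.exists_pendant_max hℓ.le
  obtain ⟨hm, xm, hxm, hmax⟩ := u.exists_halfLine_max (by omega)
  have hS := height_pos hp
  rcases le_or_gt (2 * |u.val (some hm) xm|) |u.val none xM| with hc | hc
  · have hMpos : 0 < |u.val none xM| := by
      refine abs_pos.2 fun h0 => ?_
      rw [h0, abs_zero] at hc hM
      obtain ⟨e, x, hx, hne⟩ := hu
      cases e with
      | none => exact hne (abs_nonpos_iff.1 (hM x hx))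
      | some h => exact hne (abs_nonpos_iff.1 ((hmax h x hx).trans (by linarith)))
    set t := 2 * height p / |u.val none xM| with ht
    have htp : 0 < t := by positivity
    have htM : t * |u.val none xM| = 2 * height p := by rw [ht]; field_simp
    have hle : ∀ h : Fin H, ∀ x, 0 ≤ x → |t * u.val (some h) x| ≤ height p := fun h x hx => by
      rw [abs_mul, abs_of_pos htp]
      have := mul_le_mul_of_nonneg_left (hmax h x hx) htp.le
      nlinarith
    refine ⟨t, htp.ne', (u.scale t).lt_action_of_pendant hp hℓ h₀ hle ?_ ?_ ⟨xM, hxM, ?_⟩⟩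
    · have := hle hm 0 le_rfl
      rwa [u.vertex (some hm) none] at this
    · intro x hx
      change |t * _| ≤ _
      rw [abs_mul, abs_of_pos htp, ← htM]
      exact mul_le_mul_of_nonneg_left (hM x hx) htp.le
    · change |t * _| = _
      rw [abs_mul, abs_of_pos htp, htM]
  · have hmne : u.val (some hm) xm ≠ 0 := fun h0 => by
      rw [h0, abs_zero, mul_zero] at hc
      exact absurd (abs_nonneg _) (not_le.2 hc)
    -- Dividing by the signed value makes the rescaled extremum `+height p`, whatever the sign of
    -- `u` there.
    set t := height p / u.val (some hm) xm with ht
    have htm : t * u.val (some hm) xm = height p := by rw [ht]; field_simp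
    have htm' : |t| * |u.val (some hm) xm| = height p := by
      rw [← abs_mul, htm, abs_of_pos hS]
    refine ⟨t, div_ne_zero hS.ne' hmne, (u.scale t).lt_action_of_halfLine hp hH hℓ h₁ h₂ ?_ ?_
      ⟨hm, xm, hxm, htm⟩⟩
    · intro h x hx
      change |t * _| ≤ _
      rw [abs_mul, ← htm']
      exact mul_le_mul_of_nonneg_left (hmax h x hx) (abs_nonneg t)
    · intro x hx
      change |t * _| ≤ _
      rw [abs_mul, ← htm']
      have := mul_le_mul_of_nonneg_left ((hM x hx).trans hc.le) (abs_nonneg t)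
      linarith

end H1

theorem exists_pendant_length_bound {p : ℝ} (hp : 2 < p) : ∃ ℓ₀ : ℝ, 0 < ℓ₀ ∧ ∀ ℓ, 0 < ℓ → ℓ < ℓ₀ →
    4 * cost p (height p) < height p ^ 2 / ℓ - ℓ * (2 * height p) ^ p ∧
    ℓ * (2 * height p) ^ p < 2 * cost p (height p / 2) ∧
    ℓ * (2 * height p) ^ p ≤ (height p / 2) ^ 2 / ℓ := by
  have hS := height_pos hp
  have hc := cost_pos hp (half_pos hS) (by linarith)
  have hid : Tendsto (fun ℓ : ℝ => ℓ * (2 * height p) ^ p) (𝓝[>] 0) (𝓝 0) := by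
    have : Tendsto (fun ℓ : ℝ => ℓ * (2 * height p) ^ p) (𝓝 0) (𝓝 (0 * (2 * height p) ^ p)) :=
      tendsto_id.mul_const _
    rw [zero_mul] at this
    exact this.mono_left nhdsWithin_le_nhds
  have hinv : ∀ A : ℝ, 0 < A → Tendsto (fun ℓ : ℝ => A / ℓ) (𝓝[>] 0) atTop := fun A hA =>
    tendsto_inv_nhdsGT_zero.const_mul_atTop hA
  have e1 := hid.eventually_lt_const (mul_pos two_pos hc)
  have e2 := hid.eventually_lt_const zero_lt_one
  have e3 := (hinv (height p ^ 2) (by positivity)).eventually_gt_atTop (4 * cost p (height p) + 1)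
  have e4 := (hinv ((height p / 2) ^ 2) (by positivity)).eventually_gt_atTop 1
  have e := (e1.and e2).and (e3.and e4)
  obtain ⟨ℓ₀, hℓ₀, h⟩ := mem_nhdsGT_iff_exists_Ioo_subset.1 e
  refine ⟨ℓ₀, hℓ₀, fun ℓ h0 h1 => ?_⟩
  obtain ⟨⟨a1, a2⟩, a3, a4⟩ := h ⟨h0, h1⟩
  exact ⟨by linarith, a1, by linarith⟩

/-! ### Translated integrals and the energy of the soliton -/

theorem setIntegral_Ici_shift (F : ℝ → ℝ) (y : ℝ) :
    ∫ x in Ici 0, F (x + y) = ∫ x in Ioi y, F x := by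
  rw [integral_Ici_eq_integral_Ioi]
  have := (measurePreserving_add_right volume y).setIntegral_preimage_emb
    (MeasurableEquiv.addRight y).measurableEmbedding F (Ioi y)
  rw [← this]
  simp

theorem setIntegral_Ici_shift_eq_sub {F : ℝ → ℝ} (hF : Continuous F) (hi : IntegrableOn F (Ici 0))
    {y : ℝ} (hy : 0 ≤ y) :
    ∫ x in Ici 0, F (x + y) = (∫ x in Ici 0, F x) - ∫ x in (0 : ℝ)..y, F x := by
  rw [setIntegral_Ici_shift, integral_Ici_eq_integral_Ioi, intervalIntegral.integral_of_le hy,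
    eq_sub_iff_add_eq', ← setIntegral_union Ioc_disjoint_Ioi_same measurableSet_Ioi
      (hF.integrableOn_Ioc) (hi.mono_set (Ioi_subset_Ici_self.trans (Ici_subset_Ici.2 hy))),
    Ioc_union_Ioi_eq_Ioi hy]

theorem setIntegral_Ici_shift_neg {F : ℝ → ℝ} (hF : Continuous F) (he : ∀ x, F (-x) = F x)
    (hi : IntegrableOn F (Ici 0)) {y : ℝ} (hy : 0 ≤ y) :
    ∫ x in Ici 0, F (x + -y) = (∫ x in Ici 0, F x) + ∫ x in (0 : ℝ)..y, F x := by
  have h1 : ∫ x in (0 : ℝ)..y, F x = ∫ x in (-y)..0, F x := by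
    have := intervalIntegral.integral_comp_neg (a := 0) (b := y) F
    simpa [he] using this
  rw [setIntegral_Ici_shift, h1, integral_Ici_eq_integral_Ioi,
    intervalIntegral.integral_of_le (neg_nonpos.2 hy), add_comm,
    ← setIntegral_union Ioc_disjoint_Ioi_same measurableSet_Ioi
      (hF.integrableOn_Ioc) (hi.mono_set Ioi_subset_Ici_self), Ioc_union_Ioi_eq_Ioi (by linarith)]

theorem tendsto_setIntegral_Ici_shift {F : ℝ → ℝ} (hF : Continuous F)
    (hi : IntegrableOn F (Ici 0)) :
    Tendsto (fun y => ∫ x in Ici 0, F (x + y)) atTop (𝓝 0) := by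
  have h1 := (intervalIntegral_tendsto_integral_Ioi 0 (hi.mono_set Ioi_subset_Ici_self)
    tendsto_id).const_sub (∫ x in Ici 0, F x)
  rw [integral_Ici_eq_integral_Ioi, sub_self] at h1
  refine h1.congr' ?_
  filter_upwards [eventually_ge_atTop 0] with y hy
  rw [setIntegral_Ici_shift_eq_sub hF hi hy, id, integral_Ici_eq_integral_Ioi]

section SolitonEnergy

variable {p : ℝ}

/-- The squared `H¹` norm of half a soliton. -/
noncomputable def halfMass (p : ℝ) : ℝ := ∫ x in Ici 0, (dsoliton p x ^ 2 + soliton p x ^ 2)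

theorem isH1HalfLine_soliton_zero (hp : 2 < p) : IsH1HalfLine (soliton p) (dsoliton p) := by
  simpa using isH1HalfLine_soliton hp 0

theorem integrable_soliton_energy (hp : 2 < p) :
    IntegrableOn (fun x => dsoliton p x ^ 2 + soliton p x ^ 2) (Ici 0) :=
  (isH1HalfLine_soliton_zero hp).integrable_sq_grad.add
    (isH1HalfLine_soliton_zero hp).integrable_sq_val

/-- Nehari's identity: test the equation of the soliton with the soliton itself; the boundary term
vanishes because `φ'(0) = 0`. -/
theorem halfMass_eq (hp : 2 < p) : halfMass p = ∫ x in Ici 0, |soliton p x| ^ p := by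
  have hs := isH1HalfLine_soliton_zero hp
  have h1 := hs.integral_mul (by simpa using isH1HalfLine_dsoliton hp 0)
  rw [dsoliton_zero, mul_zero, neg_zero] at h1
  have h2 : ∀ x, dsoliton p x * dsoliton p x + soliton p x * (soliton p x - soliton p x ^ (p - 1)) =
      (dsoliton p x ^ 2 + soliton p x ^ 2) - |soliton p x| ^ p := fun x => by
    have h0 := soliton_pos hp x
    rw [rpow_sub_one_eq h0, abs_of_pos h0, rpow_eq_mul_sq (p := p) h0]; ring
  simp only [h2] at h1
  rw [integral_sub (integrable_soliton_energy hp) (hs.integrable_rpow hp)] at h1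
  exact sub_eq_zero.1 h1

/-- Equality in the calibration, because `-φ' = speed φ` on the half-line. -/
theorem two_mul_cost_height (hp : 2 < p) :
    2 * cost p (height p) = ∫ x in Ici 0, (dsoliton p x ^ 2 + quad p (soliton p x)) := by
  have hs := isH1HalfLine_soliton_zero hp
  have h1 := intervalIntegral_tendsto_integral_Ioi 0
    ((hs.integrable_density hp).mono_set Ioi_subset_Ici_self) tendsto_id
  rw [← integral_Ici_eq_integral_Ioi] at h1
  have h2 : Tendsto (fun b => -2 * (cost p (soliton p b) - cost p (soliton p 0))) atTop
      (𝓝 (-2 * (cost p 0 - cost p (soliton p 0)))) :=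
    ((((continuous_cost hp).tendsto 0).comp hs.tendsto_zero).sub_const _).const_mul _
  rw [cost_zero, soliton_zero] at h2
  refine (show 2 * cost p (height p) = -2 * (0 - cost p (height p)) by ring).trans
    (tendsto_nhds_unique h2 (h1.congr' ?_))
  filter_upwards [eventually_ge_atTop 0] with b hb
  rw [← soliton_zero, ← (hs.isPrim hb).integral_comp (hasDerivAt_cost hp) (continuous_speed hp),
    ← intervalIntegral.integral_const_mul]
  refine intervalIntegral.integral_congr fun x hx => ?_
  rw [id, uIcc_of_le hb] at hx
  have hd : dsoliton p x ≤ 0 := by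
    rcases eq_or_lt_of_le hx.1 with h | h
    · rw [← h, dsoliton_zero]
    · exact (dsoliton_neg_of_pos hp h).le
  have h3 : speed p (soliton p x) = -dsoliton p x := by
    rw [speed, ← dsoliton_sq hp, Real.sqrt_sq_eq_abs, abs_of_nonpos hd]
  simp only [h3, ← dsoliton_sq hp]
  ring

theorem halfMass_mul (hp : 2 < p) : (1 - 2 / p) * halfMass p = 2 * cost p (height p) := by
  have hs := isH1HalfLine_soliton_zero hp
  have h1 : ∀ x, dsoliton p x ^ 2 + quad p (soliton p x) =
      (dsoliton p x ^ 2 + soliton p x ^ 2) - 2 / p * |soliton p x| ^ p := fun x => by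
    rw [quad]; ring
  rw [two_mul_cost_height hp]
  simp only [h1]
  rw [integral_sub (integrable_soliton_energy hp)
    ((hs.integrable_rpow hp).const_mul _), integral_const_mul, ← halfMass_eq hp]
  change _ = halfMass p - _
  ring

theorem halfMass_pos (hp : 2 < p) : 0 < halfMass p := by
  have h1 := halfMass_mul hp
  have h2 := cost_pos hp (height_pos hp) le_rfl
  have h3 : 0 < 1 - 2 / p := sub_pos.2 ((div_lt_one (by linarith)).2 hp)
  by_contra h
  push Not at h
  nlinarith

end SolitonEnergy

/-! ### Solitons sent to infinity and absence of minimizers -/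

/-- Bernoulli's inequality with exponent `p / 2` at `τ² - 1`. The left side is the normalised action
along the ray through the soliton, maximal at `τ = 1`. -/
theorem sq_sub_rpow_le {p τ : ℝ} (hp : 2 < p) (hτ : 0 ≤ τ) :
    τ ^ 2 - 2 / p * τ ^ p ≤ 1 - 2 / p := by
  have h1 := one_add_mul_self_le_rpow_one_add (s := τ ^ 2 - 1) (p := p / 2)
    (by nlinarith [sq_nonneg τ]) (by linarith)
  have h2 : (1 + (τ ^ 2 - 1)) ^ (p / 2) = τ ^ p := by
    rw [add_sub_cancel, ← Real.rpow_natCast τ 2, ← Real.rpow_mul hτ]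
    congr 1; push_cast; ring
  rw [h2] at h1
  have h3 := mul_le_mul_of_nonneg_left h1 (by positivity : 0 ≤ 2 / p)
  have h4 : 2 / p * (1 + p / 2 * (τ ^ 2 - 1)) = 2 / p + (τ ^ 2 - 1) := by field_simp
  linarith

theorem sum_ite_zero {H : ℕ} (hH : 0 < H) (G : ℝ → ℝ) (n : ℝ) :
    ∑ h : Fin H, G (if (h : ℕ) = 0 then -n else n) = G (-n) + (H - 1) * G n := by
  obtain ⟨k, rfl⟩ := Nat.exists_eq_succ_of_ne_zero hH.ne'
  simp [Fin.sum_univ_succ]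

namespace H1

variable {H : ℕ} {ℓ p : ℝ}

theorem energy_nonneg (u : H1 H ℓ) : 0 ≤ u.energy := by
  refine add_nonneg (mul_nonneg (by norm_num) ?_) (mul_nonneg (by norm_num) ?_) <;>
  exact Finset.sum_nonneg fun e _ => integral_nonneg fun x => sq_nonneg _

theorem energy_scale (u : H1 H ℓ) (t : ℝ) : (u.scale t).energy = t ^ 2 * u.energy := by
  simp only [energy, graphIntegral, scale, mul_pow, integral_const_mul, ← Finset.mul_sum]
  ring

theorem graphIntegral_rpow_scale (u : H1 H ℓ) (t : ℝ) :
    graphIntegral ℓ (fun e x => |(u.scale t).val e x| ^ p) =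
      |t| ^ p * graphIntegral ℓ fun e x => |u.val e x| ^ p := by
  simp only [graphIntegral, scale, abs_mul, Real.mul_rpow (abs_nonneg _) (abs_nonneg _),
    integral_const_mul, ← Finset.mul_sum]

/-- A soliton centred at the point `n` of the first half-line. -/
noncomputable def travelling (hp : 2 < p) (H : ℕ) (ℓ n : ℝ) : H1 H ℓ where
  val
    | none, _ => soliton p n
    | some h, x => soliton p (x + if (h : ℕ) = 0 then -n else n)
  grad
    | none, _ => 0
    | some h, x => dsoliton p (x + if (h : ℕ) = 0 then -n else n)
  memLp_val
    | none => by
      have : IsFiniteMeasure (volume.restrict (Icc 0 ℓ)) := ⟨by simp⟩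
      exact memLp_const (μ := volume.restrict (Icc 0 ℓ)) (soliton p n)
    | some h => (isH1HalfLine_soliton hp _).memLp_val
  memLp_grad
    | none => MemLp.zero'
    | some h => (isH1HalfLine_soliton hp _).memLp_grad
  val_eq
    | none, x, _ => by simp
    | some h, x, hx => (isH1HalfLine_soliton hp _).eq x hx
  vertex := by
    have : ∀ h : Fin H, soliton p (0 + if (h : ℕ) = 0 then -n else n) = soliton p n := fun h => by
      split_ifs <;> simp [soliton_neg]
    rintro (_ | h₁) (_ | h₂) <;> simp only [this]

/-- The first half-line misses one tail of the profile and a second half-line supplies it; the other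
`H - 2` carry superfluous tails. -/
theorem sum_shift_eq {F : ℝ → ℝ} (hF : Continuous F) (he : ∀ x, F (-x) = F x)
    (hi : IntegrableOn F (Ici 0)) (hH : 0 < H) {n : ℝ} (hn : 0 ≤ n) :
    ∑ h : Fin H, ∫ x in Ici 0, F (x + if (h : ℕ) = 0 then -n else n) =
      2 * (∫ x in Ici 0, F x) + (H - 2) * ∫ x in Ici 0, F (x + n) := by
  rw [sum_ite_zero hH (fun y => ∫ x in Ici 0, F (x + y)), setIntegral_Ici_shift_neg hF he hi hn,
    setIntegral_Ici_shift_eq_sub hF hi hn]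
  ring

theorem energy_travelling (hp : 2 < p) (hH : 0 < H) (hℓ : 0 ≤ ℓ) {n : ℝ} (hn : 0 ≤ n) :
    (travelling hp H ℓ n).energy = halfMass p + 1 / 2 * ((H - 2) *
      (∫ x in Ici 0, (dsoliton p (x + n) ^ 2 + soliton p (x + n) ^ 2)) + ℓ * soliton p n ^ 2) := by
  have hs := isH1HalfLine_soliton_zero hp
  have h1 := sum_shift_eq (F := fun x => dsoliton p x ^ 2 + soliton p x ^ 2)
    (((continuous_dsoliton hp).pow 2).add ((continuous_soliton hp).pow 2))
    (fun x => by rw [soliton_neg, dsoliton_neg, neg_sq])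
    (integrable_soliton_energy hp) hH hn
  have h2 : ∀ y, ∫ x in Ici 0, (dsoliton p (x + y) ^ 2 + soliton p (x + y) ^ 2) =
      (∫ x in Ici 0, dsoliton p (x + y) ^ 2) + ∫ x in Ici 0, soliton p (x + y) ^ 2 := fun y =>
    integral_add (isH1HalfLine_soliton hp y).integrable_sq_grad
      (isH1HalfLine_soliton hp y).integrable_sq_val
  have h3 : ∑ h : Fin H, ∫ x in Ici 0, (dsoliton p (x + if (h : ℕ) = 0 then -n else n) ^ 2 +
      soliton p (x + if (h : ℕ) = 0 then -n else n) ^ 2) =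
      (∑ h : Fin H, ∫ x in Ici 0, dsoliton p (x + if (h : ℕ) = 0 then -n else n) ^ 2) +
      ∑ h : Fin H, ∫ x in Ici 0, soliton p (x + if (h : ℕ) = 0 then -n else n) ^ 2 := by
    rw [← Finset.sum_add_distrib]
    exact Finset.sum_congr rfl fun h _ => h2 _
  rw [h3] at h1
  rw [energy, graphIntegral_eq, graphIntegral_eq]
  simp only [travelling, integral_const, smul_eq_mul]
  simp only [ne_eq, OfNat.ofNat_ne_zero, not_false_eq_true, zero_pow, mul_zero, zero_add,
    measureReal_restrict_apply_univ, Real.volume_real_Icc_of_le hℓ, sub_zero]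
  change _ = (∫ x in Ici 0, (dsoliton p x ^ 2 + soliton p x ^ 2)) + _
  linarith

theorem two_mul_halfMass_le (hp : 2 < p) (hH : 2 ≤ H) {n : ℝ} (hn : 0 ≤ n) :
    2 * halfMass p ≤ graphIntegral ℓ fun e x => |(travelling hp H ℓ n).val e x| ^ p := by
  have hs := isH1HalfLine_soliton_zero hp
  have h1 := sum_shift_eq (F := fun x => |soliton p x| ^ p)
    ((continuous_soliton hp).abs.rpow_const fun _ => Or.inr (by linarith))
    (fun x => by rw [soliton_neg]) (hs.integrable_rpow hp) (by omega : 0 < H) hn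
  have h2 : (2 : ℝ) ≤ H := by exact_mod_cast hH
  have h3 : 0 ≤ ∫ x in Ici 0, |soliton p (x + n)| ^ p := integral_nonneg fun x => by positivity
  have h4 : 0 ≤ ∫ x in Icc 0 ℓ, |soliton p n| ^ p := integral_nonneg fun x => by positivity
  rw [graphIntegral_eq, halfMass_eq hp]
  simp only [travelling]
  rw [h1]
  nlinarith

end H1

/-- Rescale the travelling soliton to meet the constraint and let `n → ∞`. Its excess energy
vanishes, and its `p`-norm is never below that of the soliton on the line, so the scaling factor is
at most the one for the line. -/
theorem variationalLevel_le {H : ℕ} {ℓ p μ : ℝ} (hp : 2 < p) (hH : 2 ≤ H) (hℓ : 0 ≤ ℓ)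
    (hμ : 0 < μ) :
    variationalLevel p μ H ℓ ≤ ((p * μ / (2 * halfMass p)) ^ (1 / p)) ^ 2 * halfMass p := by
  have hs := isH1HalfLine_soliton_zero hp
  have hm := halfMass_pos hp
  have hT := tendsto_setIntegral_Ici_shift (F := fun x => dsoliton p x ^ 2 + soliton p x ^ 2)
    (((continuous_dsoliton hp).pow 2).add ((continuous_soliton hp).pow 2))
    (integrable_soliton_energy hp)
  have hlim : Tendsto (fun n : ℝ => ((p * μ / (2 * halfMass p)) ^ (1 / p)) ^ 2 *
      (halfMass p + 1 / 2 * ((H - 2) *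
      (∫ x in Ici 0, (dsoliton p (x + n) ^ 2 + soliton p (x + n) ^ 2)) + ℓ * soliton p n ^ 2)))
      atTop (𝓝 (((p * μ / (2 * halfMass p)) ^ (1 / p)) ^ 2 *
        (halfMass p + 1 / 2 * ((H - 2) * 0 + ℓ * 0 ^ 2)))) :=
    (((((hT.const_mul _).add (((tendsto_soliton hp).pow 2).const_mul _)).const_mul _).const_add
      _).const_mul _)
  have h0 : ((p * μ / (2 * halfMass p)) ^ (1 / p)) ^ 2 *
      (halfMass p + 1 / 2 * (((H : ℝ) - 2) * 0 + ℓ * 0 ^ 2)) =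
      ((p * μ / (2 * halfMass p)) ^ (1 / p)) ^ 2 * halfMass p := by ring
  rw [h0] at hlim
  refine ge_of_tendsto hlim ?_
  filter_upwards [eventually_ge_atTop 0] with n hn
  rw [← H1.energy_travelling hp (by omega) hℓ hn]
  set w := H1.travelling hp H ℓ n
  set B := graphIntegral ℓ fun e x => |w.val e x| ^ p with hB
  have hBle : 2 * halfMass p ≤ B := H1.two_mul_halfMass_le hp hH hn
  have hBpos : 0 < B := by linarith
  have hpμ : 0 < p * μ := mul_pos (by linarith) hμ
  set t := (p * μ / B) ^ (1 / p) with ht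
  have ht0 : 0 ≤ t := Real.rpow_nonneg (by positivity) _
  have htp : t ^ p = p * μ / B := by
    rw [ht, ← Real.rpow_mul (by positivity), one_div_mul_cancel (by linarith), Real.rpow_one]
  have hcon : (w.scale t).MeetsConstraint p μ := by
    rw [H1.MeetsConstraint, H1.graphIntegral_rpow_scale, ← hB, abs_of_nonneg ht0, htp]
    have : p ≠ 0 := by linarith
    field_simp
  have hle : variationalLevel p μ H ℓ ≤ (w.scale t).energy :=
    csInf_le ⟨0, by rintro _ ⟨v, -, rfl⟩; exact v.energy_nonneg⟩ ⟨_, hcon, rfl⟩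
  refine hle.trans ?_
  rw [H1.energy_scale]
  refine mul_le_mul_of_nonneg_right (pow_le_pow_left₀ ht0 ?_ 2) w.energy_nonneg
  refine Real.rpow_le_rpow (by positivity) ?_ (by positivity)
  gcongr

/-- A minimizer would have `‖u‖_p^p = 2 halfMass r^p` and energy at most `r² halfMass`, as for `r φ`
on the line. With `τ = |t| r`, the doubled action of `t u` is then at most `2 halfMass (τ² - (2/p)
τ^p) ≤ 4 cost S`, against `exists_lt_action`. -/
theorem not_isMinimizer {H : ℕ} {ℓ p μ : ℝ} (hp : 2 < p) (hH : 3 ≤ H) (hℓ : 0 < ℓ) (hμ : 0 < μ)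
    (h₀ : 4 * cost p (height p) < height p ^ 2 / ℓ - ℓ * (2 * height p) ^ p)
    (h₁ : ℓ * (2 * height p) ^ p < 2 * cost p (height p / 2))
    (h₂ : ℓ * (2 * height p) ^ p ≤ (height p / 2) ^ 2 / ℓ) (u : H1 H ℓ) :
    ¬ u.IsMinimizer p μ := by
  rintro ⟨hcon, hen⟩
  have hm := halfMass_pos hp
  have hpμ : 0 < p * μ := mul_pos (by linarith) hμ
  have hB : graphIntegral ℓ (fun e x => |u.val e x| ^ p) = p * μ := by
    rw [← hcon]
    have : p ≠ 0 := by linarith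
    field_simp
  have hne : ∃ e, ∃ x ∈ dom ℓ e, u.val e x ≠ 0 := by
    by_contra! hall
    rw [graphIntegral, Finset.sum_eq_zero] at hB
    · exact hpμ.ne hB
    · intro e _
      have hmeas : MeasurableSet (dom ℓ e) := by
        cases e
        · exact measurableSet_Icc
        · exact measurableSet_Ici
      rw [setIntegral_congr_fun hmeas (g := fun _ => 0) fun x hx => by
        simp [hall e x hx, Real.zero_rpow (by linarith : p ≠ 0)]]
      simp
  obtain ⟨t, -, ht⟩ := u.exists_lt_action hp hH hℓ h₀ h₁ h₂ hne
  rw [u.action_scale hp hℓ.le, hB] at ht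
  set r := (p * μ / (2 * halfMass p)) ^ (1 / p) with hr
  have hr0 : 0 ≤ r := Real.rpow_nonneg (by positivity) _
  have hrp : r ^ p = p * μ / (2 * halfMass p) := by
    rw [hr, ← Real.rpow_mul (by positivity), one_div_mul_cancel (by linarith), Real.rpow_one]
  have hE : u.energy ≤ r ^ 2 * halfMass p := by
    rw [hen]; exact variationalLevel_le hp (by omega) hℓ.le hμ
  have hpm : p * μ = 2 * halfMass p * r ^ p := by rw [hrp]; field_simp
  have h3 := sq_sub_rpow_le hp (mul_nonneg (abs_nonneg t) hr0)
  rw [mul_pow, sq_abs, Real.mul_rpow (abs_nonneg t) hr0] at h3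
  have h4 := mul_le_mul_of_nonneg_left h3 (mul_nonneg zero_le_two hm.le)
  have h5 := mul_le_mul_of_nonneg_left hE (sq_nonneg t)
  have h6 := halfMass_mul hp
  rw [hpm] at ht
  linarith

/-! ### Inverses of functions with derivative bounded below -/

section Inverse

variable {F F' : ℝ → ℝ} {m : ℝ}

theorem strictMono_of_le_deriv (hF : ∀ x, HasDerivAt F (F' x) x) (hm : 0 < m)
    (h : ∀ x, m ≤ F' x) : StrictMono F :=
  strictMono_of_deriv_pos fun x => by rw [(hF x).deriv]; exact hm.trans_le (h x)

theorem surjective_of_le_deriv (hF : ∀ x, HasDerivAt F (F' x) x) (hm : 0 < m)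
    (h : ∀ x, m ≤ F' x) : Function.Surjective F := by
  have hmono : Monotone fun x => F x - m * x :=
    have hd : ∀ x, HasDerivAt (fun x => F x - m * x) (F' x - m * 1) x := fun x =>
      (hF x).sub ((hasDerivAt_id x).const_mul m)
    monotone_of_deriv_nonneg (fun x => (hd x).differentiableAt) fun x => by
      rw [(hd x).deriv]
      linarith [h x]
  have hc : Continuous F := continuous_iff_continuousAt.2 fun x => (hF x).continuousAt
  refine hc.surjective ?_ ?_
  · refine tendsto_atTop_mono' atTop (f₁ := fun x => F 0 + m * x) ?_
      (tendsto_atTop_add_const_left _ _ (tendsto_id.const_mul_atTop hm))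
    filter_upwards [eventually_ge_atTop 0] with x hx
    have := hmono hx
    simp only [mul_zero, sub_zero] at this
    linarith
  · refine tendsto_atBot_mono' atBot (f₁ := fun x => F 0 + m * x) ?_
      (tendsto_atBot_add_const_left _ _ (tendsto_id.const_mul_atBot hm))
    filter_upwards [eventually_le_atBot 0] with x hx
    have := hmono hx
    simp only [mul_zero, sub_zero] at this
    linarith

theorem apply_invFun_of_le_deriv (hF : ∀ x, HasDerivAt F (F' x) x) (hm : 0 < m)
    (h : ∀ x, m ≤ F' x) (y : ℝ) : F (Function.invFun F y) = y :=
  Function.invFun_eq (surjective_of_le_deriv hF hm h y)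

theorem invFun_apply_of_le_deriv (hF : ∀ x, HasDerivAt F (F' x) x) (hm : 0 < m)
    (h : ∀ x, m ≤ F' x) (x : ℝ) : Function.invFun F (F x) = x :=
  Function.leftInverse_invFun (strictMono_of_le_deriv hF hm h).injective x

theorem strictMono_invFun_of_le_deriv (hF : ∀ x, HasDerivAt F (F' x) x) (hm : 0 < m)
    (h : ∀ x, m ≤ F' x) : StrictMono (Function.invFun F) := fun x y hxy => by
  rw [← (strictMono_of_le_deriv hF hm h).lt_iff_lt, apply_invFun_of_le_deriv hF hm h,
    apply_invFun_of_le_deriv hF hm h]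
  exact hxy

theorem hasDerivAt_invFun_of_le_deriv (hF : ∀ x, HasDerivAt F (F' x) x) (hm : 0 < m)
    (h : ∀ x, m ≤ F' x) (y : ℝ) :
    HasDerivAt (Function.invFun F) (F' (Function.invFun F y))⁻¹ y := by
  have hc : Continuous (Function.invFun F) :=
    (strictMono_invFun_of_le_deriv hF hm h).monotone.continuous_of_surjective
      fun x => ⟨F x, invFun_apply_of_le_deriv hF hm h x⟩
  exact HasDerivAt.of_local_left_inverse hc.continuousAt (hF _) (hm.trans_le (h _)).ne'
    (Eventually.of_forall fun z => apply_invFun_of_le_deriv hF hm h z)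

end Inverse

/-! ### The potential on the pendant -/

section Potential

variable {p : ℝ}

/-- A level strictly between the constant solution `1` and the top of the soliton. -/
noncomputable def base (p : ℝ) : ℝ := (1 + height p) / 2

/-- The force `v^(p-1) - v`, frozen below the level `base p`. -/
noncomputable def force (p t : ℝ) : ℝ := max t (base p) ^ (p - 1) - max t (base p)

/-- The potential of the force, equal to `-quad p` above the level `base p`. -/
noncomputable def pot (p t : ℝ) : ℝ := -quad p (base p) + ∫ x in (base p)..t, 2 * force p x

/-- The inverse of the potential. -/
noncomputable def potInv (p : ℝ) : ℝ → ℝ := Function.invFun (pot p)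

theorem one_lt_base (hp : 2 < p) : 1 < base p := by
  have := one_lt_height hp
  rw [base]; linarith

theorem base_lt_height (hp : 2 < p) : base p < height p := by
  have := one_lt_height hp
  rw [base]; linarith

theorem quad_base_pos (hp : 2 < p) : 0 < quad p (base p) :=
  quad_pos hp (by linarith [one_lt_base hp]) (base_lt_height hp)

theorem continuous_force (hp : 2 < p) : Continuous (force p) := by
  have h : Continuous fun t => max t (base p) := continuous_id.max continuous_const
  exact (h.rpow_const fun _ => Or.inr (by linarith)).sub h

theorem monotone_force (hp : 2 < p) : Monotone (force p) := fun s t hst => by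
  have h1 : max s (base p) ≤ max t (base p) := max_le_max_right _ hst
  have h2 : 1 < max s (base p) := (one_lt_base hp).trans_le (le_max_right _ _)
  have h3 : max s (base p) ^ (p - 2) ≤ max t (base p) ^ (p - 2) :=
    Real.rpow_le_rpow (by linarith) h1 (by linarith)
  have h4 : 1 < max s (base p) ^ (p - 2) := Real.one_lt_rpow h2 (by linarith)
  rw [force, force, rpow_sub_one_eq (by linarith), rpow_sub_one_eq (by linarith)]
  nlinarith

theorem force_base_pos (hp : 2 < p) : 0 < force p (base p) := by
  have h2 := one_lt_base hp
  have h4 : 1 < base p ^ (p - 2) := Real.one_lt_rpow h2 (by linarith)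
  rw [force, max_self, rpow_sub_one_eq (by linarith)]
  nlinarith

/-- Purpose of the freezing: the force has a positive lower bound on all of `ℝ`, so `pot` is a
global increasing bijection. The orbits that are used stay above `base p`, where the force is the
true one. -/
theorem force_base_le (hp : 2 < p) (t : ℝ) : force p (base p) ≤ force p t := by
  have h1 : force p (max t (base p)) = force p t := by simp [force]
  rw [← h1]
  exact monotone_force hp (le_max_right _ _)

theorem force_pos (hp : 2 < p) (t : ℝ) : 0 < force p t :=
  (force_base_pos hp).trans_le (force_base_le hp t)

theorem hasDerivAt_pot (hp : 2 < p) (t : ℝ) : HasDerivAt (pot p) (2 * force p t) t := by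
  have hc : Continuous fun x => 2 * force p x := (continuous_force hp).const_mul 2
  exact (intervalIntegral.integral_hasDerivAt_right (hc.intervalIntegrable _ _)
    (hc.stronglyMeasurableAtFilter _ _) hc.continuousAt).const_add _

theorem pot_eq (hp : 2 < p) {t : ℝ} (ht : base p ≤ t) : pot p t = -quad p t := by
  have hb := one_lt_base hp
  have hd : ∀ x ∈ uIcc (base p) t, HasDerivAt (fun x => 2 / p * x ^ p - x ^ 2) (2 * force p x) x := by
    intro x hx
    rw [uIcc_of_le ht] at hx
    have h0 : 0 < x := by linarith [hx.1]
    have h1 := (((hasDerivAt_id x).rpow_const (p := p) (Or.inl h0.ne')).const_mul (2 / p)).sub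
      (hasDerivAt_pow 2 x)
    convert! h1 using 1
    rw [force, max_eq_left hx.1, id]
    have : p ≠ 0 := by linarith
    field_simp
    ring
  have h2 := intervalIntegral.integral_eq_sub_of_hasDerivAt hd
    (((continuous_force hp).const_mul 2).intervalIntegrable _ _)
  rw [pot, h2, quad, quad, abs_of_pos (by linarith), abs_of_pos (by linarith)]
  ring

theorem le_deriv_pot (hp : 2 < p) (t : ℝ) : 2 * force p (base p) ≤ 2 * force p t :=
  mul_le_mul_of_nonneg_left (force_base_le hp t) zero_le_two

theorem pot_potInv (hp : 2 < p) (w : ℝ) : pot p (potInv p w) = w :=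
  apply_invFun_of_le_deriv (hasDerivAt_pot hp) (mul_pos two_pos (force_base_pos hp))
    (le_deriv_pot hp) w

theorem potInv_pot (hp : 2 < p) (t : ℝ) : potInv p (pot p t) = t :=
  invFun_apply_of_le_deriv (hasDerivAt_pot hp) (mul_pos two_pos (force_base_pos hp))
    (le_deriv_pot hp) t

theorem strictMono_potInv (hp : 2 < p) : StrictMono (potInv p) :=
  strictMono_invFun_of_le_deriv (hasDerivAt_pot hp) (mul_pos two_pos (force_base_pos hp))
    (le_deriv_pot hp)

theorem hasDerivAt_potInv (hp : 2 < p) (w : ℝ) :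
    HasDerivAt (potInv p) (2 * force p (potInv p w))⁻¹ w :=
  hasDerivAt_invFun_of_le_deriv (hasDerivAt_pot hp) (mul_pos two_pos (force_base_pos hp))
    (le_deriv_pot hp) w

theorem continuous_potInv (hp : 2 < p) : Continuous (potInv p) :=
  continuous_iff_continuousAt.2 fun x => (hasDerivAt_potInv hp x).continuousAt

theorem base_le_potInv (hp : 2 < p) {w : ℝ} (hw : -quad p (base p) ≤ w) :
    base p ≤ potInv p w := by
  rw [← potInv_pot hp (base p), pot_eq hp le_rfl]
  exact (strictMono_potInv hp).monotone hw

theorem quad_potInv (hp : 2 < p) {w : ℝ} (hw : -quad p (base p) ≤ w) :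
    quad p (potInv p w) = -w := by
  have h := pot_eq hp (base_le_potInv hp hw)
  rw [pot_potInv hp] at h
  linarith

theorem force_eq {t : ℝ} (ht : base p ≤ t) : force p t = t ^ (p - 1) - t := by
  rw [force, max_eq_left ht]

theorem potInv_zero (hp : 2 < p) : potInv p 0 = height p := by
  have h : pot p (height p) = 0 := by
    have hS := height_pos hp
    rw [pot_eq hp (base_lt_height hp).le, quad_eq_mul hp, abs_of_pos hS, height_rpow hp]
    have : p ≠ 0 := by linarith
    field_simp
    ring
  rw [← h, potInv_pot hp]

theorem tendsto_potInv (hp : 2 < p) : Tendsto (potInv p) atTop atTop :=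
  tendsto_atTop_atTop_of_monotone (strictMono_potInv hp).monotone fun b =>
    ⟨pot p b, (potInv_pot hp b).ge⟩

end Potential

/-! ### Travel time as an integral over the velocity -/

section Time

variable {p : ℝ}

/-- The inverse of the deceleration along the orbit of energy `e`, at velocity `z`. -/
noncomputable def slowness (p e z : ℝ) : ℝ := (force p (potInv p (e - z ^ 2)))⁻¹

/-- The time in which the velocity decreases from `z` to `0` along the orbit of energy `e`. -/
noncomputable def time (p e z : ℝ) : ℝ := ∫ ζ in (0 : ℝ)..z, slowness p e ζ

theorem continuous_slowness (hp : 2 < p) :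
    Continuous (Function.uncurry (slowness p)) := by
  refine Continuous.inv₀ ?_ fun x => (force_pos hp _).ne'
  exact (continuous_force hp).comp ((continuous_potInv hp).comp
    (continuous_fst.sub (continuous_snd.pow 2)))

theorem continuous_slowness_right (hp : 2 < p) (e : ℝ) : Continuous (slowness p e) :=
  (continuous_slowness hp).comp (Continuous.prodMk_right e)

theorem slowness_pos (hp : 2 < p) (e z : ℝ) : 0 < slowness p e z := inv_pos.2 (force_pos hp _)

theorem inv_force_le_slowness (hp : 2 < p) {e z w : ℝ} (h : e - z ^ 2 ≤ w) :
    (force p (potInv p w))⁻¹ ≤ slowness p e z :=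
  inv_anti₀ (force_pos hp _) (monotone_force hp ((strictMono_potInv hp).monotone h))

theorem slowness_le_inv_force (hp : 2 < p) {e z w : ℝ} (h : w ≤ e - z ^ 2) :
    slowness p e z ≤ (force p (potInv p w))⁻¹ :=
  inv_anti₀ (force_pos hp _) (monotone_force hp ((strictMono_potInv hp).monotone h))

theorem hasDerivAt_time (hp : 2 < p) (e z : ℝ) : HasDerivAt (time p e) (slowness p e z) z := by
  have hc := continuous_slowness_right hp e
  exact intervalIntegral.integral_hasDerivAt_right (hc.intervalIntegrable _ _)
    (hc.stronglyMeasurableAtFilter _ _) hc.continuousAt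

/-- Velocity `0` marks the top of the orbit, where the force is largest. The resulting lower bound
on the derivative makes `time p e` invertible. -/
theorem slowness_zero_le (hp : 2 < p) (e z : ℝ) : slowness p e 0 ≤ slowness p e z := by
  refine (inv_force_le_slowness hp (w := e) (by nlinarith [sq_nonneg z])).trans' (le_of_eq ?_)
  simp [slowness]

/-- The velocity at time `t` before it vanishes, along the orbit of energy `e`. -/
noncomputable def velocity (p e : ℝ) : ℝ → ℝ := Function.invFun (time p e)

theorem velocity_time (hp : 2 < p) (e z : ℝ) : velocity p e (time p e z) = z :=
  invFun_apply_of_le_deriv (hasDerivAt_time hp e) (slowness_pos hp e 0) (slowness_zero_le hp e) z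

theorem velocity_zero (hp : 2 < p) (e : ℝ) : velocity p e 0 = 0 := by
  have := velocity_time hp e 0
  rwa [time, intervalIntegral.integral_same] at this

theorem strictMono_velocity (hp : 2 < p) (e : ℝ) : StrictMono (velocity p e) :=
  strictMono_invFun_of_le_deriv (hasDerivAt_time hp e) (slowness_pos hp e 0) (slowness_zero_le hp e)

theorem hasDerivAt_velocity (hp : 2 < p) (e t : ℝ) :
    HasDerivAt (velocity p e) (force p (potInv p (e - velocity p e t ^ 2))) t := by
  have := hasDerivAt_invFun_of_le_deriv (hasDerivAt_time hp e) (slowness_pos hp e 0)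
    (slowness_zero_le hp e) t
  rwa [slowness, inv_inv] at this

theorem continuous_time (hp : 2 < p) : Continuous fun x : ℝ × ℝ => time p x.1 x.2 :=
  intervalIntegral.continuous_parametric_primitive_of_continuous (continuous_slowness hp)

theorem inv_force_le_time (hp : 2 < p) {e z : ℝ} (hz : 1 ≤ z) :
    (force p (potInv p e))⁻¹ ≤ time p e z := by
  have h1 : ∫ _ζ in (0 : ℝ)..z, (force p (potInv p e))⁻¹ ≤ time p e z :=
    intervalIntegral.integral_mono_on (by linarith) intervalIntegrable_const
      ((continuous_slowness_right hp e).intervalIntegrable _ _)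
      fun ζ _ => inv_force_le_slowness hp (by nlinarith [sq_nonneg ζ])
  rw [intervalIntegral.integral_const, smul_eq_mul, sub_zero] at h1
  have h2 : 0 < (force p (potInv p e))⁻¹ := inv_pos.2 (force_pos hp _)
  nlinarith

/-- Split at velocity `√x`. The slower part lies above `potInv p x`, where the force is at least its
value there; on the faster part, time is at most displacement over `√x`. -/
theorem time_le (hp : 2 < p) {x z : ℝ} (hx : 0 < x) (hz : √x ≤ z)
    (hb : -quad p (base p) ≤ 2 * x - z ^ 2) :
    time p (2 * x) z ≤ √x * (force p (potInv p x))⁻¹ + potInv p x / √x := by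
  have hc := continuous_slowness_right hp (2 * x)
  have hsx : 0 < √x := Real.sqrt_pos.2 hx
  have hsq : √x ^ 2 = x := Real.sq_sqrt hx.le
  have h1 : ∫ ζ in (0 : ℝ)..√x, slowness p (2 * x) ζ ≤
      ∫ _ζ in (0 : ℝ)..√x, (force p (potInv p x))⁻¹ :=
    intervalIntegral.integral_mono_on hsx.le (hc.intervalIntegrable _ _) intervalIntegrable_const
      fun ζ hζ => slowness_le_inv_force hp (by nlinarith [hζ.1, hζ.2])
  rw [intervalIntegral.integral_const, smul_eq_mul, sub_zero] at h1
  have hd : ∀ ζ, HasDerivAt (fun ζ => -potInv p (2 * x - ζ ^ 2)) (ζ * slowness p (2 * x) ζ) ζ := by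
    intro ζ
    have h := ((hasDerivAt_potInv hp (2 * x - ζ ^ 2)).comp ζ
      ((hasDerivAt_pow 2 ζ).const_sub (2 * x))).neg
    convert! h using 1
    rw [slowness]
    have := (force_pos hp (potInv p (2 * x - ζ ^ 2))).ne'
    field_simp
    ring
  have hci : Continuous fun ζ => ζ * slowness p (2 * x) ζ := continuous_id.mul hc
  have h2 := intervalIntegral.integral_eq_sub_of_hasDerivAt (a := √x) (b := z)
    (fun ζ _ => hd ζ) (hci.intervalIntegrable _ _)
  have h3 : ∫ ζ in (√x)..z, slowness p (2 * x) ζ ≤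
      ∫ ζ in (√x)..z, (√x)⁻¹ * (ζ * slowness p (2 * x) ζ) := by
    refine intervalIntegral.integral_mono_on hz (hc.intervalIntegrable _ _)
      ((hci.const_mul _).intervalIntegrable _ _) fun ζ hζ => ?_
    rw [← mul_assoc]
    refine le_mul_of_one_le_left (slowness_pos hp _ _).le ?_
    rw [inv_mul_eq_div, one_le_div hsx]
    exact hζ.1
  rw [intervalIntegral.integral_const_mul, h2, hsq, inv_mul_eq_div] at h3
  have h4 : (-potInv p (2 * x - z ^ 2) - -potInv p (2 * x - x)) / √x ≤ potInv p x / √x := by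
    have h5 := base_le_potInv hp hb
    have h6 := one_lt_base hp
    rw [show 2 * x - x = x by ring]
    gcongr
    linarith
  rw [time, ← intervalIntegral.integral_add_adjacent_intervals (hc.intervalIntegrable 0 (√x))
    (hc.intervalIntegrable _ z)]
  linarith

/-- With `v = potInv p x` and `x = v² Y`, both terms are at most `Y^(-1/2)`, and `Y = (2/p) v^(p-2)
- 1` tends to infinity because `p > 2`. -/
theorem tendsto_time_bound (hp : 2 < p) :
    Tendsto (fun x => √x * (force p (potInv p x))⁻¹ + potInv p x / √x) atTop (𝓝 0) := by
  have hY : Tendsto (fun x => 2 / p * potInv p x ^ (p - 2) - 1) atTop atTop :=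
    tendsto_atTop_add_const_right _ (-1) (((tendsto_rpow_atTop (by linarith : 0 < p - 2)).comp
      (tendsto_potInv hp)).const_mul_atTop (by positivity))
  have hlim : Tendsto (fun x => 2 * (√(2 / p * potInv p x ^ (p - 2) - 1))⁻¹) atTop (𝓝 (2 * 0)) :=
    ((tendsto_inv_atTop_zero.comp (Real.tendsto_sqrt_atTop.comp hY))).const_mul 2
  rw [mul_zero] at hlim
  refine squeeze_zero' ?_ ?_ hlim
  · filter_upwards [(tendsto_potInv hp).eventually_ge_atTop 0] with x hx
    have := force_pos hp (potInv p x)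
    positivity
  · filter_upwards [hY.eventually_gt_atTop 0, eventually_ge_atTop 0] with x hY0 hx0
    have hw : -quad p (base p) ≤ x := by linarith [quad_base_pos hp]
    have hv := base_le_potInv hp hw
    have hq := quad_potInv hp hw
    have hb := one_lt_base hp
    set v := potInv p x
    have hv0 : 0 < v := by linarith
    set Y := 2 / p * v ^ (p - 2) - 1 with hYdef
    have hxY : x = v ^ 2 * Y := by
      rw [quad_eq_mul hp, abs_of_pos hv0] at hq
      rw [hYdef]; linarith
    have hsqrt : √x = v * √Y := by
      rw [hxY, Real.sqrt_mul (sq_nonneg _), Real.sqrt_sq hv0.le]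
    have hsY : 0 < √Y := Real.sqrt_pos.2 hY0
    have hYY : √Y * √Y = Y := Real.mul_self_sqrt hY0.le
    have hforce : v * Y ≤ force p v := by
      rw [force_eq hv, rpow_sub_one_eq hv0, hYdef]
      have h2 : 2 / p ≤ 1 := (div_le_one (by linarith)).2 hp.le
      have h3 : 0 < v ^ (p - 2) := Real.rpow_pos_of_pos hv0 _
      have h4 : v * (2 / p * v ^ (p - 2)) ≤ v * (1 * v ^ (p - 2)) := by gcongr
      linarith
    have e1 : √x * (force p v)⁻¹ ≤ (√Y)⁻¹ := by
      rw [hsqrt, ← div_eq_mul_inv, div_le_iff₀ (force_pos hp v), inv_mul_eq_div, le_div_iff₀ hsY,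
        mul_assoc, hYY]
      exact hforce
    have e2 : v / √x = (√Y)⁻¹ := by
      rw [hsqrt]; field_simp
    linarith

end Time

/-! ### Orbits glued to solitons and the two bound-states -/

section Orbit

variable {p : ℝ}

/-- The orbit of energy `e`, run backwards from its highest point. -/
noncomputable def orbit (p e t : ℝ) : ℝ := potInv p (e - velocity p e t ^ 2)

theorem hasDerivAt_orbit (hp : 2 < p) (e t : ℝ) :
    HasDerivAt (orbit p e) (-velocity p e t) t := by
  have h := (hasDerivAt_potInv hp (e - velocity p e t ^ 2)).comp t
    (((hasDerivAt_velocity hp e t).pow 2).const_sub e)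
  convert! h using 1
  have := (force_pos hp (potInv p (e - velocity p e t ^ 2))).ne'
  push_cast
  field_simp

theorem orbit_zero (hp : 2 < p) (e : ℝ) : orbit p e 0 = potInv p e := by
  simp [orbit, velocity_zero hp]

theorem continuous_velocity (hp : 2 < p) (e : ℝ) : Continuous (velocity p e) :=
  continuous_iff_continuousAt.2 fun t => (hasDerivAt_velocity hp e t).continuousAt

theorem continuous_orbit (hp : 2 < p) (e : ℝ) : Continuous (orbit p e) :=
  continuous_iff_continuousAt.2 fun t => (hasDerivAt_orbit hp e t).continuousAt

theorem base_le_orbit (hp : 2 < p) {e ℓ t : ℝ} (ht : t ∈ Icc 0 ℓ)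
    (hb : -quad p (base p) ≤ e - velocity p e ℓ ^ 2) : base p ≤ orbit p e t := by
  refine base_le_potInv hp (hb.trans ?_)
  have h1 := (strictMono_velocity hp e).monotone ht.1
  have h2 := (strictMono_velocity hp e).monotone ht.2
  rw [velocity_zero hp] at h1
  have := pow_le_pow_left₀ h1 h2 2
  linarith

theorem _root_.Continuous.memLp_two_Icc {f : ℝ → ℝ} (hf : Continuous f) (a b : ℝ) :
    MemLp f 2 (volume.restrict (Icc a b)) := by
  rw [memLp_two_iff_integrable_sq hf.aestronglyMeasurable]
  exact (hf.pow 2).integrableOn_Icc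

/-- The orbit of energy `e` on the pendant, glued to translated solitons on the half-lines. -/
noncomputable def H1.glue (hp : 2 < p) (H : ℕ) {ℓ e y : ℝ} (hv : orbit p e ℓ = soliton p y) :
    H1 H ℓ where
  val
    | none, x => orbit p e (ℓ - x)
    | some _, x => soliton p (x + y)
  grad
    | none, x => velocity p e (ℓ - x)
    | some _, x => dsoliton p (x + y)
  memLp_val
    | none => ((continuous_orbit hp e).comp (continuous_sub_left ℓ)).memLp_two_Icc 0 ℓ
    | some _ => (isH1HalfLine_soliton hp y).memLp_val
  memLp_grad
    | none => ((continuous_velocity hp e).comp (continuous_sub_left ℓ)).memLp_two_Icc 0 ℓ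
    | some _ => (isH1HalfLine_soliton hp y).memLp_grad
  val_eq
    | none, x, _ => by
      have hd : ∀ t ∈ uIcc 0 x, HasDerivAt (fun t => orbit p e (ℓ - t)) (velocity p e (ℓ - t)) t :=
        fun t _ => by simpa using (hasDerivAt_orbit hp e (ℓ - t)).comp_const_sub ℓ t
      simp only
      rw [intervalIntegral.integral_eq_sub_of_hasDerivAt hd
        (((continuous_velocity hp e).comp (continuous_sub_left ℓ)).intervalIntegrable _ _)]
      ring
    | some _, x, hx => (isH1HalfLine_soliton hp y).eq x hx
  vertex := by
    rintro (_ | h₁) (_ | h₂) <;> simp [hv]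

theorem strictAntiOn_soliton (hp : 2 < p) : StrictAntiOn (soliton p) (Ici 0) := by
  refine strictAntiOn_of_deriv_neg (convex_Ici 0) (continuous_soliton hp).continuousOn fun x hx => ?_
  rw [interior_Ici] at hx
  rw [(hasDerivAt_soliton hp x).deriv]
  exact dsoliton_neg_of_pos hp hx

theorem H1.isIncreasing_glue (hp : 2 < p) {H : ℕ} {ℓ e y : ℝ} (hv : orbit p e ℓ = soliton p y)
    (hy : 0 < y) : (H1.glue hp H hv).IsIncreasing := by
  constructor
  · refine strictMonoOn_of_deriv_pos (convex_Icc 0 ℓ)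
      ((continuous_orbit hp e).comp (continuous_sub_left ℓ)).continuousOn fun x hx => ?_
    rw [interior_Icc] at hx
    have hd : HasDerivAt (fun t => orbit p e (ℓ - t)) (velocity p e (ℓ - x)) x := by
      simpa using (hasDerivAt_orbit hp e (ℓ - x)).comp_const_sub ℓ x
    change 0 < deriv (fun t => orbit p e (ℓ - t)) x
    rw [hd.deriv, ← velocity_zero hp e]
    exact strictMono_velocity hp e (by linarith [hx.2])
  · intro h x hx x' hx' hlt
    have h0 : (0 : ℝ) ≤ x := hx
    have h1 : (0 : ℝ) ≤ x' := hx'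
    exact strictAntiOn_soliton hp (mem_Ici.2 (by linarith)) (mem_Ici.2 (by linarith))
      (by linarith)

theorem H1.hasIncidenceIndex_glue (hp : 2 < p) {H : ℕ} {ℓ e y : ℝ}
    (hv : orbit p e ℓ = soliton p y) (hy : 0 < y) :
    (H1.glue hp H hv).HasIncidenceIndex p (H : ℝ) H 0 := by
  have h1 : ∀ h, h ∈ (H1.glue hp H hv).solitonHalfLines p y := fun h x _ => rfl
  have h2 : (H1.glue hp H hv).solitonHalfLines p (-y) = ∅ := by
    refine eq_empty_of_forall_notMem fun h hh => ?_
    -- Evaluation at `x = y` would give `φ(2y) = φ(0)`.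
    have h3 : soliton p (y + y) = soliton p (y + -y) := hh y hy.le
    rw [add_neg_cancel] at h3
    exact (strictAntiOn_soliton hp (mem_Ici.2 le_rfl) (mem_Ici.2 (by linarith))
      (by linarith : 0 < y + y)).ne h3
  refine ⟨⟨y, hy, fun h => Or.inl (h1 h), ?_, by simp [h2]⟩, by norm_num⟩
  rw [eq_univ_of_forall h1, ncard_univ, Nat.card_eq_fintype_card, Fintype.card_fin]

/-- Integration by parts leaves only vertex terms, as the velocity vanishes at the free end; `hk` is
Kirchhoff's condition, which cancels them. `hb` keeps the orbit above `base p`. -/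
theorem H1.isBoundState_glue (hp : 2 < p) {H : ℕ} {ℓ e y : ℝ} (hℓ : 0 < ℓ)
    (hv : orbit p e ℓ = soliton p y) (hb : -quad p (base p) ≤ e - velocity p e ℓ ^ 2)
    (hk : velocity p e ℓ + H * dsoliton p y = 0) : (H1.glue hp H hv).IsBoundState p := by
  refine ⟨⟨none, 0, ⟨le_rfl, hℓ.le⟩, ?_⟩, fun η => ?_⟩
  · change orbit p e (ℓ - 0) ≠ 0
    rw [sub_zero, hv]
    exact (soliton_pos hp y).ne'
  rw [graphIntegral_eq]
  have hhalf : ∀ h : Fin H, ∫ x in Ici 0, ((H1.glue hp H hv).grad (some h) x * η.grad (some h) x +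
      (H1.glue hp H hv).val (some h) x * η.val (some h) x -
      |(H1.glue hp H hv).val (some h) x| ^ (p - 2) * (H1.glue hp H hv).val (some h) x *
        η.val (some h) x) = -(dsoliton p y * η.val none 0) := fun h => by
    have h1 := (isH1HalfLine_dsoliton hp y).integral_mul (η.isH1HalfLine h)
    rw [zero_add, η.vertex (some h) none] at h1
    rw [← h1]
    refine integral_congr_ae (Eventually.of_forall fun x => ?_)
    simp only [H1.glue]
    rw [abs_of_pos (soliton_pos hp _), rpow_sub_one_eq (soliton_pos hp _)]
    ring
  have hpend : ∫ x in Icc 0 ℓ, ((H1.glue hp H hv).grad none x * η.grad none x +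
      (H1.glue hp H hv).val none x * η.val none x -
      |(H1.glue hp H hv).val none x| ^ (p - 2) * (H1.glue hp H hv).val none x *
        η.val none x) = -(velocity p e ℓ * η.val none 0) := by
    have hcf : Continuous fun x => -force p (orbit p e (ℓ - x)) :=
      ((continuous_force hp).comp ((continuous_orbit hp e).comp (continuous_sub_left ℓ))).neg
    have hprim : IsPrim (fun x => velocity p e (ℓ - x)) (fun x => -force p (orbit p e (ℓ - x)))
        0 ℓ := IsPrim.of_hasDerivAt hℓ.le
      ((continuous_velocity hp e).comp (continuous_sub_left ℓ)).continuousOn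
      (fun x _ => (hasDerivAt_velocity hp e (ℓ - x)).comp_const_sub ℓ x)
      (hcf.intervalIntegrable _ _)
    have h1 := hprim.integral_mul (η.isPrim hℓ.le)
    simp only [sub_self, velocity_zero hp, zero_mul, sub_zero, zero_sub] at h1
    rw [← h1, intervalIntegral.integral_of_le hℓ.le, ← integral_Icc_eq_integral_Ioc]
    refine setIntegral_congr_fun measurableSet_Icc fun x hx => ?_
    have h2 := base_le_orbit hp (t := ℓ - x) ⟨by linarith [hx.2], by linarith [hx.1]⟩ hb
    have h3 : 0 < orbit p e (ℓ - x) := by linarith [one_lt_base hp]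
    simp only [H1.glue]
    rw [force_eq h2, abs_of_pos h3, rpow_sub_one_eq h3]
    ring
  rw [hpend, Finset.sum_congr rfl fun h _ => hhalf h, Finset.sum_const, Finset.card_univ,
    Fintype.card_fin, nsmul_eq_mul]
  linear_combination (-η.val none 0) * hk

theorem exists_soliton_eq (hp : 2 < p) {s : ℝ} (hs : 0 < s) (hs' : s < height p) :
    ∃ y, 0 < y ∧ soliton p y = s := by
  obtain ⟨R, hR⟩ := ((tendsto_soliton hp).eventually_lt_const hs |>.and
    (eventually_ge_atTop 0)).exists
  obtain ⟨y, hy, hys⟩ := intermediate_value_Icc' hR.2 (continuous_soliton hp).continuousOn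
    (show s ∈ Icc (soliton p R) (soliton p 0) from ⟨hR.1.le, by rw [soliton_zero]; exact hs'.le⟩)
  refine ⟨y, lt_of_le_of_ne hy.1 fun h => ?_, hys⟩
  rw [← h, soliton_zero] at hys
  exact hs'.ne hys.symm

/-- Here `d` is `quad p` of the vertex value, so the soliton leaves with slope `-√d`. The value at
the free end is recorded to tell solutions with different `d` apart. -/
theorem exists_increasing_boundState (hp : 2 < p) {H : ℕ} {ℓ d : ℝ} (hℓ : 0 < ℓ) (hd : 0 < d)
    (hdb : d ≤ quad p (base p)) (ht : time p ((H ^ 2 - 1) * d) (H * √d) = ℓ) :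
    ∃ u : H1 H ℓ, (u.IsBoundState p ∧ u.IsPositive ∧ u.IsSymmetric ∧ u.IsIncreasing ∧
      u.HasIncidenceIndex p (H : ℝ) H 0) ∧ u.val none ℓ = potInv p ((H ^ 2 - 1) * d) := by
  set e := ((H : ℝ) ^ 2 - 1) * d with he
  have hvel : velocity p e ℓ = H * √d := by rw [← ht, velocity_time hp]
  have hed : e - velocity p e ℓ ^ 2 = -d := by
    rw [hvel, mul_pow, Real.sq_sqrt hd.le, he]; ring
  have hb : -quad p (base p) ≤ e - velocity p e ℓ ^ 2 := by rw [hed]; linarith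
  have horb : orbit p e ℓ = potInv p (-d) := by rw [orbit, hed]
  have hs : 0 < potInv p (-d) := by
    linarith [base_le_potInv hp (w := -d) (by linarith), one_lt_base hp]
  obtain ⟨y, hy, hys⟩ := exists_soliton_eq hp hs (by
    rw [← potInv_zero hp]; exact strictMono_potInv hp (by linarith))
  have hv : orbit p e ℓ = soliton p y := by rw [horb, hys]
  have hds : dsoliton p y = -√d := by
    have h1 := dsoliton_sq hp y
    rw [hys, quad_potInv hp (by linarith), neg_neg] at h1
    rw [← h1, Real.sqrt_sq_eq_abs, abs_of_neg (dsoliton_neg_of_pos hp hy), neg_neg]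
  refine ⟨H1.glue hp H hv, ⟨H1.isBoundState_glue hp hℓ hv hb (by rw [hvel, hds]; ring), ?_,
    fun _ _ _ _ => rfl, H1.isIncreasing_glue hp hv hy, H1.hasIncidenceIndex_glue hp hv hy⟩, ?_⟩
  · intro e' x hx
    cases e' with
    | none =>
      have := base_le_orbit hp (t := ℓ - x) ⟨by linarith [hx.2], by linarith [hx.1]⟩ hb
      change 0 < orbit p e (ℓ - x)
      linarith [one_lt_base hp]
    | some h => exact soliton_pos hp _
  · change orbit p e (ℓ - ℓ) = _
    rw [sub_self, orbit_zero hp]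

theorem continuous_time_vertex (hp : 2 < p) (H : ℕ) :
    Continuous fun d : ℝ => time p ((H ^ 2 - 1) * d) (H * √d) :=
  (continuous_time hp).comp (f := fun d : ℝ => (((H : ℝ) ^ 2 - 1) * d, (H : ℝ) * √d))
    ((continuous_const.mul continuous_id).prodMk (continuous_const.mul Real.continuous_sqrt))

theorem eventually_time_lt (hp : 2 < p) {ε : ℝ} (hε : 0 < ε) :
    ∀ᶠ H : ℕ in atTop,
      time p ((H ^ 2 - 1) * quad p (base p)) (H * √(quad p (base p))) < ε ∧ 2 ≤ H ∧
      1 ≤ ((H : ℝ) ^ 2 - 1) * quad p (base p) := by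
  set c := quad p (base p) with hc
  have hc0 : 0 < c := quad_base_pos hp
  have h1 : Tendsto (fun H : ℕ => ((H : ℝ) ^ 2 - 1) * c) atTop atTop :=
    (tendsto_atTop_add_const_right _ (-1) ((tendsto_pow_atTop two_ne_zero).comp
      tendsto_natCast_atTop_atTop)).atTop_mul_const hc0
  have h2 : Tendsto (fun H : ℕ => ((H : ℝ) ^ 2 - 1) * c / 2) atTop atTop :=
    h1.atTop_div_const two_pos
  filter_upwards [h2.eventually ((tendsto_time_bound hp).eventually_lt_const hε),
    h2.eventually_gt_atTop 0, eventually_ge_atTop 2, h1.eventually_ge_atTop 1] with H ha hx hH hone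
  refine ⟨lt_of_le_of_lt ?_ ha, hH, hone⟩
  have h3 := time_le hp (x := ((H : ℝ) ^ 2 - 1) * c / 2) (z := H * √c) hx ?_ ?_
  · rwa [mul_div_cancel₀ _ (two_ne_zero' ℝ)] at h3
  · rw [show (H : ℝ) * √c = √((H : ℝ) ^ 2 * c) by
      rw [Real.sqrt_mul (sq_nonneg _), Real.sqrt_sq (Nat.cast_nonneg H)]]
    refine Real.sqrt_le_sqrt ?_
    nlinarith [mul_nonneg (sq_nonneg (H : ℝ)) hc0.le]
  · rw [mul_pow, Real.sq_sqrt hc0.le]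
    linarith

theorem exists_two_boundStates (hp : 2 < p) : ∃ H₀ : ℕ, ∀ H : ℕ, H₀ ≤ H →
    ∃ ℓ₁ ℓ₂ : ℝ, 0 < ℓ₁ ∧ ℓ₁ < ℓ₂ ∧ ∀ ℓ ∈ Icc ℓ₁ ℓ₂,
      ∃ u v : H1 H ℓ, u.Distinct v ∧
        (u.IsBoundState p ∧ u.IsPositive ∧ u.IsSymmetric ∧ u.IsIncreasing ∧
          u.HasIncidenceIndex p (H : ℝ) H 0) ∧
        (v.IsBoundState p ∧ v.IsPositive ∧ v.IsSymmetric ∧ v.IsIncreasing ∧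
          v.HasIncidenceIndex p (H : ℝ) H 0) := by
  -- `T` bounds the travel time from below at energy `1` for initial velocities at least `1`,
  -- uniformly in `H`.
  set T := (force p (potInv p 1))⁻¹ with hT
  have hT0 : 0 < T := inv_pos.2 (force_pos hp _)
  obtain ⟨H₀, hH₀⟩ := eventually_atTop.1 (eventually_time_lt hp (half_pos hT0))
  refine ⟨H₀, fun H hH => ⟨T / 2, 3 * T / 4, by linarith, by linarith, fun ℓ hℓ => ?_⟩⟩
  obtain ⟨hlt, hH2, hone⟩ := hH₀ H hH
  have hℓ0 : 0 < ℓ := by linarith [hℓ.1]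
  have hH2' : (2 : ℝ) ≤ H := by exact_mod_cast hH2
  have hpos : 0 < (H : ℝ) ^ 2 - 1 := by nlinarith
  set c := quad p (base p) with hc
  -- The parameter at which the energy `(H^2 - 1) d` equals `1`.
  set d₁ := 1 / ((H : ℝ) ^ 2 - 1) with hd₁
  have hd₁0 : 0 < d₁ := one_div_pos.2 hpos
  have hd₁c : d₁ ≤ c := by rw [hd₁, div_le_iff₀ hpos]; linarith
  have hmul : ((H : ℝ) ^ 2 - 1) * d₁ = 1 := mul_one_div_cancel hpos.ne'
  have hmid : T ≤ time p ((H ^ 2 - 1) * d₁) (H * √d₁) := by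
    rw [hmul]
    refine inv_force_le_time hp ?_
    have h1 : (H : ℝ) ^ 2 * d₁ = 1 + d₁ := by linarith
    rw [← Real.sqrt_sq (Nat.cast_nonneg H : (0 : ℝ) ≤ H), ← Real.sqrt_mul (sq_nonneg _), h1,
      Real.one_le_sqrt]
    linarith
  have hzero : time p ((H ^ 2 - 1) * 0) (H * √0) = 0 := by simp [time]
  have hcont := continuous_time_vertex hp H
  obtain ⟨d, hd, hdℓ⟩ := intermediate_value_Icc hd₁0.le hcont.continuousOn
    (show ℓ ∈ Icc _ _ from ⟨by rw [hzero]; exact hℓ0.le, by linarith [hℓ.2]⟩)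
  obtain ⟨d', hd', hdℓ'⟩ := intermediate_value_Icc' hd₁c hcont.continuousOn
    (show ℓ ∈ Icc _ _ from ⟨hlt.le.trans hℓ.1, by linarith [hℓ.2]⟩)
  simp only at hdℓ hdℓ'
  have hd0 : 0 < d := lt_of_le_of_ne hd.1 fun h => by
    rw [← h, hzero] at hdℓ
    exact hℓ0.ne hdℓ
  -- A common value would be `d₁`, where the time is at least `T > 3T/4 ≥ ℓ`.
  have hne : d < d' := lt_of_le_of_ne (hd.2.trans hd'.1) fun h => by
    have h1 : d = d₁ := le_antisymm hd.2 (by rw [h]; exact hd'.1)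
    rw [h1] at hdℓ
    linarith [hℓ.2]
  obtain ⟨u, hu, hul⟩ := exists_increasing_boundState hp hℓ0 hd0 (hd.2.trans hd₁c) hdℓ
  obtain ⟨v, hv, hvl⟩ := exists_increasing_boundState hp hℓ0 (hd0.trans hne) hd'.2 hdℓ'
  refine ⟨u, v, ⟨none, ℓ, ⟨hℓ0.le, le_rfl⟩, ?_⟩, hu, hv⟩
  rw [hul, hvl]
  exact (strictMono_potInv hp (mul_lt_mul_of_pos_left hne hpos)).ne

end Orbit

end Broom

theorem mainTheorem10 (p : ℝ) (hp : 2 < p) :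
    (∃ H₀ : ℕ, ∀ H : ℕ, H₀ ≤ H →
      ∃ ℓ₁ ℓ₂ : ℝ, 0 < ℓ₁ ∧ ℓ₁ < ℓ₂ ∧ ∀ ℓ ∈ Set.Icc ℓ₁ ℓ₂,
        ∃ u v : Broom.H1 H ℓ, u.Distinct v ∧
          (u.IsBoundState p ∧ u.IsPositive ∧ u.IsSymmetric ∧ u.IsIncreasing ∧
            u.HasIncidenceIndex p (H : ℝ) H 0) ∧
          (v.IsBoundState p ∧ v.IsPositive ∧ v.IsSymmetric ∧ v.IsIncreasing ∧
            v.HasIncidenceIndex p (H : ℝ) H 0)) ∧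
    (∀ H : ℕ, 3 ≤ H →
      ∃ ℓ₀ : ℝ, 0 < ℓ₀ ∧ ∀ ℓ : ℝ, 0 < ℓ → ℓ < ℓ₀ →
        ∀ μ : ℝ, 0 < μ → ¬ ∃ u : Broom.H1 H ℓ, u.IsMinimizer p μ) := by
  refine ⟨Broom.exists_two_boundStates hp, fun H hH => ?_⟩
  obtain ⟨ℓ₀, hℓ₀, h⟩ := Broom.exists_pendant_length_bound hp
  refine ⟨ℓ₀, hℓ₀, fun ℓ h0 h1 μ hμ => ?_⟩
  rintro ⟨u, hu⟩
  obtain ⟨a₀, a₁, a₂⟩ := h ℓ h0 h1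
  exact Broom.not_isMinimizer hp hH h0 hμ a₀ a₁ a₂ u hu
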